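/- Let $I,J\subset\mathbb{R}$ be open, let $\eta_1=\eta_1(x)$ and $\eta_2=\eta_2(y)$ be smooth real functions on $I$ and $J$ respectively, not such that $\eta_1(x)=\eta_2(y)$ for all $(x,y)\in I\times J$, and let $\mathcal{E}$ be the infinitely prolonged system $$u_{yy}=\frac{\frac12\eta_1'v^2v_x+\frac12\eta_2'uvu_y+(\eta_1-\eta_2)uu_yv_y+u^2v^3}{uv(\eta_1-\eta_2)},\qquad v_{xx}=\frac{\frac12\eta_1'uvv_x+\frac12\eta_2'u^2u_y+(\eta_2-\eta_1)vv_xu_x+u^3v^2}{uv(\eta_2-\eta_1)}$$ for real functions $u,v$ of $(x,y)\in I\times J$, considered where $u\ne0$, $v\ne0$, $\eta_1\neq\eta_2$. Let $\alpha^j_{m}$, $\alpha^{jl}_{m}$ ($\{j,l\}=\{1,2\}$) be the coefficients at $\mu^m$ of the formal Taylor expansions in $\mu$ of $(1+\eta_j\mu^2)^{-1/2}$ and $(1+\eta_j\mu^2)^{1/2}(1+\eta_l\mu^2)^{-1/2}$. For complex variables $\theta_0,\theta_1,\dots$ put $T=1+\theta_1\mu+\theta_2\mu^2+\cdots$ and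 $X^{21}_0=Y^{12}_0=1$, $X^1_0=Y^2_0=0$, and for $s\ge1$ let $X^{21}_s,\ Y^{12}_s,\ X^1_s,\ Y^2_s$ be the coefficients at $\mu^s$ of, respectively, $$\Big(\sum_{m\ge 2}\alpha^{21}_m\mu^m\Big)T,\quad \Big(\sum_{m\ge 2}\alpha^{12}_m\mu^m\Big)T,\quad \frac{\mu}{2}\Big(\sum_{m\ge0}\alpha^1_m\mu^m\Big)\big(e^{\theta_0}T^2+e^{-\theta_0}\big),\quad \frac{\mu}{2}\Big(\sum_{m\ge0}\alpha^2_m\mu^m\Big)\big(e^{\theta_0}T^2-e^{-\theta_0}\big).$$ These involve only $\theta_0,\dots,\theta_{s-1}$. Let $$\omega_s=\Big(\frac{iu_y}{v}X^{21}_s+uX^1_s\Big)\,dx-\Big(\frac{iv_x}{u}Y^{12}_s+ivY^2_s\Big)\,dy ,$$ and let $\mathcal{E}_{s}$ be the covering of $\mathcal{E}$ obtained by adjoining nonlocal variables $\theta_0,\dots,\theta_s\in\mathbb{C}$ with $\theta_{k,x}\,dx+\theta_{k,y}\,dy=\omega_k$, $k=0,\dots,s$; put $\mathcal{E}_{-1}=\mathcal{E}$.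 Denote by $D_x,D_y$ the corresponding total derivatives. Then for every $s=0,1,2,\dots$ the form $\omega_s$ is a nontrivial conservation law on $\mathcal{E}_{s-1}$: writing $\omega_s=A\,dx+B\,dy$, one has $D_yA=D_xB$ on $\mathcal{E}_{s-1}$, and there is no smooth complex-valued function $f$ on $\mathcal{E}_{s-1}$ (that is, a function depending smoothly on finitely many of the jet variables and on $\theta_0,\dots,\theta_{s-1}$) with $\omega_s=d_hf=D_xf\,dx+D_yf\,dy$. Thus $\omega_0,\omega_1,\omega_2,\dots$ is an infinite hierarchy of nontrivial nonlocal conservation laws for the system. -/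

import Mathlib

open scoped ContDiff PowerSeries

noncomputable section

namespace SDeform

/-! Infinite jets of a pair of real functions `(u, v)` of two real variables `(x, y)`. -/

/-- The space of infinite jets: `(x, y, u_{ij}, v_{ij})`, where the index pair `i j` means
`i` derivatives in `x` and `j` derivatives in `y`. -/
abbrev Jet : Type := ℝ × ℝ × (ℕ → ℕ → ℝ) × (ℕ → ℕ → ℝ)

/-- The independent variable `x`. -/
def jx (p : Jet) : ℝ := p.1

/-- The independent variable `y`. -/
def jy (p : Jet) : ℝ := p.2.1

/-- The jet coordinate `∂_x^i ∂_y^j u`. -/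
def ju (i j : ℕ) (p : Jet) : ℝ := p.2.2.1 i j

/-- The jet coordinate `∂_x^i ∂_y^j v`. -/
def jv (i j : ℕ) (p : Jet) : ℝ := p.2.2.2 i j

/-- The value at `p` of the total derivative field
`∂/∂x + ∑ u_{i+1,j} ∂/∂u_{ij} + ∑ v_{i+1,j} ∂/∂v_{ij}`. -/
def jetFieldX (p : Jet) : Jet := (1, 0, fun i j => ju (i + 1) j p, fun i j => jv (i + 1) j p)

/-- The value at `p` of the total derivative field
`∂/∂y + ∑ u_{i,j+1} ∂/∂u_{ij} + ∑ v_{i,j+1} ∂/∂v_{ij}`. -/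
def jetFieldY (p : Jet) : Jet := (0, 1, fun i j => ju i (j + 1) p, fun i j => jv i (j + 1) p)

/-- The total derivative `D_x` on the jet space. -/
def jetDx (g : Jet → ℝ) (p : Jet) : ℝ := lineDeriv ℝ g p (jetFieldX p)

/-- The total derivative `D_y` on the jet space. -/
def jetDy (g : Jet → ℝ) (p : Jet) : ℝ := lineDeriv ℝ g p (jetFieldY p)

/-- The part of the jet space where the system is defined: `η₁ = η₁(x)` is given on `I`,
`η₂ = η₂(y)` is given on `J`, and the denominators `u`, `v`, `η₁ - η₂` do not vanish. -/
def jetDomain (η₁ η₂ : ℝ → ℝ) (I J : Set ℝ) : Set Jet :=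
  {p | jx p ∈ I ∧ jy p ∈ J ∧ η₁ (jx p) ≠ η₂ (jy p) ∧ ju 0 0 p ≠ 0 ∧ jv 0 0 p ≠ 0}

/-- The first equation, as the function `u_yy - (right-hand side)` of jets. -/
def eqnU (η₁ η₂ : ℝ → ℝ) (p : Jet) : ℝ :=
  let e₁ := η₁ (jx p); let e₂ := η₂ (jy p)
  let d₁ := deriv η₁ (jx p); let d₂ := deriv η₂ (jy p)
  let u := ju 0 0 p; let v := jv 0 0 p
  let u_y := ju 0 1 p; let v_x := jv 1 0 p; let v_y := jv 0 1 p
  ju 0 2 p -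
    (1 / 2 * d₁ * v ^ 2 * v_x + 1 / 2 * d₂ * u * v * u_y + (e₁ - e₂) * u * u_y * v_y
      + u ^ 2 * v ^ 3) / (u * v * (e₁ - e₂))

/-- The second equation, as the function `v_xx - (right-hand side)` of jets. -/
def eqnV (η₁ η₂ : ℝ → ℝ) (p : Jet) : ℝ :=
  let e₁ := η₁ (jx p); let e₂ := η₂ (jy p)
  let d₁ := deriv η₁ (jx p); let d₂ := deriv η₂ (jy p)
  let u := ju 0 0 p; let v := jv 0 0 p
  let u_x := ju 1 0 p; let u_y := ju 0 1 p; let v_x := jv 1 0 p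
  jv 2 0 p -
    (1 / 2 * d₁ * u * v * v_x + 1 / 2 * d₂ * u ^ 2 * u_y + (e₂ - e₁) * v * v_x * u_x
      + u ^ 3 * v ^ 2) / (u * v * (e₂ - e₁))

/-- The system `𝓔` as an infinitely prolonged equation: all jets at which the two equations and
all their total derivatives hold. -/
def equationManifold (η₁ η₂ : ℝ → ℝ) (I J : Set ℝ) : Set Jet :=
  {p | p ∈ jetDomain η₁ η₂ I J ∧ ∀ i j : ℕ,
    (jetDx^[i] (jetDy^[j] (eqnU η₁ η₂))) p = 0 ∧ (jetDx^[i] (jetDy^[j] (eqnV η₁ η₂))) p = 0}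

/-! The tower of coverings. -/

/-- The jet space extended by `n` complex nonlocal variables `θ_0, …, θ_{n-1}`. -/
abbrev Cov (n : ℕ) : Type := Jet × (Fin n → ℂ)

/-- The nonlocal variable `θ_k` (for `k < n`; extended by zero). -/
def theta {n : ℕ} (k : ℕ) (p : Cov n) : ℂ := if h : k < n then p.2 ⟨k, h⟩ else 0

/-- The formal Taylor expansion of `(1 + c μ²)^r` in the variable `μ`: the coefficient at `μ^{2k}`
is `r (r - 1) ⋯ (r - k + 1) / k! * c^k`. -/
def powSeries (r c : ℝ) : ℂ⟦X⟧ :=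
  PowerSeries.mk fun m => if Even m then
    ((((∏ i ∈ Finset.range (m / 2), (r - i)) / (Nat.factorial (m / 2) : ℝ)) * c ^ (m / 2) : ℝ) : ℂ)
    else 0

/-- The expansion `∑ α_{2k} μ^{2k}` of `1 / √(1 + c μ²)`; with `c = η_j` this gives `α_{2k}^j`. -/
def alphaSeries (c : ℝ) : ℂ⟦X⟧ := powSeries (-1 / 2) c

/-- The expansion of `√((1 + c μ²) / (1 + d μ²))`; with `c = η_j`, `d = η_l` this gives
`α_{2k}^{jl}`. -/
def alphaRatioSeries (c d : ℝ) : ℂ⟦X⟧ := powSeries (1 / 2) c * powSeries (-1 / 2) d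

/-- The formal series `1 + θ_1 μ + θ_2 μ² + ⋯`, so that `w = e^{θ_0} (1 + θ_1 μ + θ_2 μ² + ⋯)`. -/
def thetaSeries {n : ℕ} (p : Cov n) : ℂ⟦X⟧ :=
  PowerSeries.mk fun k => if k = 0 then 1 else theta k p

/-- `X_s^{21}`: equal to `1` for `s = 0`, and otherwise
`∑_{1 ≤ j ≤ s/2} α_{2j}^{21} θ_{s-2j}` with `θ_0` replaced by `1`. -/
def X21 (η₁ η₂ : ℝ → ℝ) (s : ℕ) {n : ℕ} (p : Cov n) : ℂ :=
  if s = 0 then 1 else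
    PowerSeries.coeff s ((alphaRatioSeries (η₂ (jy p.1)) (η₁ (jx p.1)) - 1) * thetaSeries p)

/-- `Y_s^{12}`: as `X_s^{21}`, with `α^{12}` in place of `α^{21}`. -/
def Y12 (η₁ η₂ : ℝ → ℝ) (s : ℕ) {n : ℕ} (p : Cov n) : ℂ :=
  if s = 0 then 1 else
    PowerSeries.coeff s ((alphaRatioSeries (η₁ (jx p.1)) (η₂ (jy p.1)) - 1) * thetaSeries p)

/-- `X_s^1`: the coefficient at `μ^s` of
`(μ / 2) (1 + η₁ μ²)^{-1/2} (e^{θ_0} (1 + θ_1 μ + ⋯)² + e^{-θ_0})`. -/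
def X1 (η₁ : ℝ → ℝ) (s : ℕ) {n : ℕ} (p : Cov n) : ℂ :=
  PowerSeries.coeff s (PowerSeries.C (1 / 2 : ℂ) * PowerSeries.X * alphaSeries (η₁ (jx p.1)) *
    (PowerSeries.C (Complex.exp (theta 0 p)) * thetaSeries p ^ 2
      + PowerSeries.C (Complex.exp (-theta 0 p))))

/-- `Y_s^2`: the coefficient at `μ^s` of
`(μ / 2) (1 + η₂ μ²)^{-1/2} (e^{θ_0} (1 + θ_1 μ + ⋯)² - e^{-θ_0})`. -/
def Y2 (η₂ : ℝ → ℝ) (s : ℕ) {n : ℕ} (p : Cov n) : ℂ :=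
  PowerSeries.coeff s (PowerSeries.C (1 / 2 : ℂ) * PowerSeries.X * alphaSeries (η₂ (jy p.1)) *
    (PowerSeries.C (Complex.exp (theta 0 p)) * thetaSeries p ^ 2
      - PowerSeries.C (Complex.exp (-theta 0 p))))

/-- The `dx`-coefficient of `ω_s`: `(i u_y / v) X_s^{21} + u X_s^1`. It involves only the nonlocal
variables `θ_k` with `k < s` (and is used on `Cov n` for `s ≤ n` only). -/
def omegaX (η₁ η₂ : ℝ → ℝ) (s : ℕ) {n : ℕ} (p : Cov n) : ℂ :=
  Complex.I * (ju 0 1 p.1 : ℂ) / (jv 0 0 p.1 : ℂ) * X21 η₁ η₂ s p + (ju 0 0 p.1 : ℂ) * X1 η₁ s p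

/-- The `dy`-coefficient of `ω_s`: `-((i v_x / u) Y_s^{12} + i v Y_s^2)`. -/
def omegaY (η₁ η₂ : ℝ → ℝ) (s : ℕ) {n : ℕ} (p : Cov n) : ℂ :=
  -(Complex.I * (jv 1 0 p.1 : ℂ) / (ju 0 0 p.1 : ℂ) * Y12 η₁ η₂ s p
    + Complex.I * (jv 0 0 p.1 : ℂ) * Y2 η₂ s p)

/-- The total derivative `D_x` on the covering with fibre coordinates `θ_0, …, θ_{n-1}`: the
derivative along the field that extends the total derivative field of the jet space by
`(θ_k)_x = (i u_y / v) X_k^{21} + u X_k^1`. -/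
def covDx (η₁ η₂ : ℝ → ℝ) {n : ℕ} (f : Cov n → ℂ) (p : Cov n) : ℂ :=
  lineDeriv ℝ f p (jetFieldX p.1, fun k : Fin n => omegaX η₁ η₂ k p)

/-- The total derivative `D_y` on the covering with fibre coordinates `θ_0, …, θ_{n-1}`. -/
def covDy (η₁ η₂ : ℝ → ℝ) {n : ℕ} (f : Cov n → ℂ) (p : Cov n) : ℂ :=
  lineDeriv ℝ f p (jetFieldY p.1, fun k : Fin n => omegaY η₁ η₂ k p)

/-- The part of `Cov n` lying over `jetDomain`. -/
def covDomain (η₁ η₂ : ℝ → ℝ) (I J : Set ℝ) (n : ℕ) : Set (Cov n) :=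
  {p | p.1 ∈ jetDomain η₁ η₂ I J}

/-- The covering equation with nonlocal variables `θ_0, …, θ_{n-1}`, i.e. `𝓔_{n-1}`, where
`𝓔_{-1} = 𝓔`. -/
def covEquation (η₁ η₂ : ℝ → ℝ) (I J : Set ℝ) (n : ℕ) : Set (Cov n) :=
  {p | p.1 ∈ equationManifold η₁ η₂ I J}

/-- The projection to finitely many coordinates: `x`, `y`, the jet coordinates `u_{ij}`, `v_{ij}`
with `i, j < k`, and all `θ`s. -/
def truncate (k n : ℕ) (p : Cov n) :
    ℝ × ℝ × (Fin k → Fin k → ℝ) × (Fin k → Fin k → ℝ) × (Fin n → ℂ) :=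
  (jx p.1, jy p.1, fun i j => ju i j p.1, fun i j => jv i j p.1, p.2)

/-- Smooth complex-valued functions on an open part `Ω` of the extended jet space: functions that
depend on finitely many coordinates only, and smoothly so (in the real sense). The smooth functions
on `covEquation` are the restrictions of the smooth functions on `covDomain`. -/
def IsSmooth {n : ℕ} (Ω : Set (Cov n)) (f : Cov n → ℂ) : Prop :=
  ∃ (k : ℕ) (F : ℝ × ℝ × (Fin k → Fin k → ℝ) × (Fin k → Fin k → ℝ) × (Fin n → ℂ) → ℂ),
    ContDiffOn ℝ ∞ F (truncate k n '' Ω) ∧ ∀ p ∈ Ω, f p = F (truncate k n p)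

/-- The horizontal form `A dx + B dy` on `𝓔_{n-1}` is a conservation law: its coefficients are
smooth and `D_y A = D_x B` holds on `𝓔_{n-1}`. -/
def IsConservationLaw (η₁ η₂ : ℝ → ℝ) (I J : Set ℝ) {n : ℕ} (A B : Cov n → ℂ) : Prop :=
  IsSmooth (covDomain η₁ η₂ I J n) A ∧ IsSmooth (covDomain η₁ η₂ I J n) B ∧
    ∀ p ∈ covEquation η₁ η₂ I J n, covDy η₁ η₂ A p = covDx η₁ η₂ B p

/-- The horizontal form `A dx + B dy` is trivial on `𝓔_{n-1}`: it is `d_h f = D_x f dx + D_y f dy`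
on `𝓔_{n-1}` for a smooth function `f`. -/
def IsTrivialForm (η₁ η₂ : ℝ → ℝ) (I J : Set ℝ) {n : ℕ} (A B : Cov n → ℂ) : Prop :=
  ∃ f : Cov n → ℂ, IsSmooth (covDomain η₁ η₂ I J n) f ∧
    ∀ p ∈ covEquation η₁ η₂ I J n, covDx η₁ η₂ f p = A p ∧ covDy η₁ η₂ f p = B p

end SDeform

end

/-!
Along each axis the covering is equivalent to a Riccati equation `W' = a W² + b W + c` for
`W = e^{θ₀} (1 + θ₁ μ + θ₂ μ² + ⋯)`, with formal power series in `μ` as coefficients. On the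
solutions of the system the two Riccati equations satisfy the zero curvature condition, whose
coefficient at `μ^s` is the conservation law for `ω_s`.

If `ω_n = d_h f`, restrict `f` to the parametric coordinates of the equation, those in which `u`
has at most one derivative in `y` and `v` at most one in `x`. Comparing `D_x f = A` and
`D_y f = B` at two points which differ in the highest parametric coordinates eliminates the latter
one level after another, so that `f` depends only on `x`, `y`, `θ₀, …, θ_{n-1}`. Hence, at fixed
`(x, y)`, for the difference of the Riccati equations along the `x`-axis at two jets, the
evolution of `θ_n` is that of the function `f(θ₀, …, θ_{n-1})`, that is, the difference lifts
through `f`. The Riccati equations which lift are closed under sums and brackets, and brackets of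
the differences obtained by varying `u` and `u_y` contain an equation which starts at the order
`μ^n` exactly. It moves `θ_n` while leaving `θ₀, …, θ_{n-1}` fixed, which is impossible for one
that lifts.
-/

noncomputable section

namespace SDeform

open Filter Topology

section Plots

variable {V W : Type*} [AddCommGroup V] [Module ℝ V] [TopologicalSpace V]
  [AddCommGroup W] [Module ℝ W] [TopologicalSpace W]
  {E F : Type} [NormedAddCommGroup E] [NormedSpace ℝ E] [NormedAddCommGroup F] [NormedSpace ℝ F]

/-- The map `γ` into a topological vector space is weakly smooth at `e`: its composition with every
continuous linear functional is smooth. This gives a calculus on the infinite-dimensional jet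
space, which carries no norm. -/
def IsPlotAt (γ : E → V) (e : E) : Prop :=
  ∀ φ : V →L[ℝ] ℝ, ContDiffAt ℝ ∞ (fun z => φ (γ z)) e

/-- The map `h` is smooth on `D`, tested on plots: it sends plots through points of `D` to plots. -/
def PlotSmoothOn (D : Set V) (h : V → W) : Prop :=
  ∀ ⦃E : Type⦄ [NormedAddCommGroup E] [NormedSpace ℝ E] ⦃γ : E → V⦄ ⦃e : E⦄,
    IsPlotAt γ e → γ e ∈ D → IsPlotAt (fun z => h (γ z)) e

/-- The set `D` is open, tested on plots. -/
def PlotOpen (D : Set V) : Prop :=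
  ∀ ⦃E : Type⦄ [NormedAddCommGroup E] [NormedSpace ℝ E] ⦃γ : E → V⦄ ⦃e : E⦄,
    IsPlotAt γ e → γ e ∈ D → ∀ᶠ z in 𝓝 e, γ z ∈ D

/-- On `D`, the function `h` takes equal values at points congruent modulo `K`. If `K` is the
common kernel of some coordinates, this says that `h` depends on these coordinates only. -/
def InvariantOn {X : Type*} (D : Set V) (K : Submodule ℝ V) (h : V → X) : Prop :=
  ∀ ⦃p⦄, p ∈ D → ∀ ⦃q⦄, q ∈ D → p ≡ q [SMOD K] → h p = h q

lemma isPlotAt_const (p : V) (e : E) : IsPlotAt (fun _ : E => p) e :=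
  fun _ => contDiffAt_const

lemma IsPlotAt.add {γ δ : E → V} {e : E} (hγ : IsPlotAt γ e) (hδ : IsPlotAt δ e) :
    IsPlotAt (fun z => γ z + δ z) e := fun φ => by
  simpa only [map_add] using (hγ φ).add (hδ φ)

lemma IsPlotAt.smul {c : E → ℝ} {γ : E → V} {e : E} (hc : ContDiffAt ℝ ∞ c e)
    (hγ : IsPlotAt γ e) : IsPlotAt (fun z => c z • γ z) e := fun φ => by
  simp only [map_smul]
  exact hc.smul (hγ φ)

lemma IsPlotAt.comp {γ : E → V} {φ : F → E} {f : F} (hγ : IsPlotAt γ (φ f))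
    (hφ : ContDiffAt ℝ ∞ φ f) : IsPlotAt (fun z => γ (φ z)) f :=
  fun ψ => (hγ ψ).comp f hφ

lemma IsPlotAt.map {γ : E → V} {e : E} (hγ : IsPlotAt γ e) (L : V →L[ℝ] W) :
    IsPlotAt (fun z => L (γ z)) e :=
  fun φ => hγ (φ.comp L)

lemma IsPlotAt.prodMk {γ : E → V} {δ : E → W} {e : E} (hγ : IsPlotAt γ e) (hδ : IsPlotAt δ e) :
    IsPlotAt (fun z => (γ z, δ z)) e := fun φ => by
  have hsplit (z : E) : φ (γ z, δ z) =
      φ.comp (.inl ℝ V W) (γ z) + φ.comp (.inr ℝ V W) (δ z) := by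
    simp [← map_add]
  simpa only [hsplit] using (hγ _).add (hδ _)

lemma exists_finset_eq_sum_single {ι : Type*} [DecidableEq ι] {B : ι → Type*}
    [∀ i, AddCommGroup (B i)] [∀ i, Module ℝ (B i)] [∀ i, TopologicalSpace (B i)]
    (φ : (∀ i, B i) →L[ℝ] ℝ) : ∃ s : Finset ι, ∀ x, φ x = ∑ i ∈ s, φ (Pi.single i (x i)) := by
  have hnhds : {x | φ x ∈ Set.Ioo (-1 : ℝ) 1} ∈ 𝓝 (0 : ∀ i, B i) :=
    φ.continuous.continuousAt.preimage_mem_nhds (Ioo_mem_nhds (by simp) (by simp))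
  rw [nhds_pi, Filter.mem_pi] at hnhds
  obtain ⟨s, hs, U, hU, hsub⟩ := hnhds
  have hvanish (x : ∀ i, B i) (hx : ∀ i ∈ s, x i = 0) : φ x = 0 := by
    by_contra hne
    have hscaled : (φ x)⁻¹ • x ∈ s.pi U := fun i hi => by
      simpa [hx i hi] using mem_of_mem_nhds (hU i)
    simpa [hne] using hsub hscaled
  refine ⟨hs.toFinset, fun x => ?_⟩
  rw [← map_sum, ← sub_eq_zero, ← map_sub]
  refine hvanish _ fun i hi => ?_
  simp [Finset.sum_apply, hi]

lemma isPlotAt_pi {ι : Type*} {B : ι → Type*} [∀ i, AddCommGroup (B i)] [∀ i, Module ℝ (B i)]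
    [∀ i, TopologicalSpace (B i)] {γ : E → ∀ i, B i} {e : E}
    (hγ : ∀ i, IsPlotAt (fun z => γ z i) e) : IsPlotAt γ e := fun φ => by
  classical
  obtain ⟨s, hs⟩ := exists_finset_eq_sum_single φ
  rw [funext fun z => hs (γ z)]
  exact ContDiffAt.sum fun i _ => hγ i (φ.comp (ContinuousLinearMap.single ℝ B i))

lemma isPlotAt_of_contDiffAt {γ : E → F} {e : E} (hγ : ContDiffAt ℝ ∞ γ e) : IsPlotAt γ e :=
  fun φ => φ.contDiff.contDiffAt.comp e hγ

lemma IsPlotAt.contDiffAt [FiniteDimensional ℝ F] {γ : E → F} {e : E} (hγ : IsPlotAt γ e) :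
    ContDiffAt ℝ ∞ γ e := by
  have hcoord : ContDiffAt ℝ ∞ (fun z => (Module.finBasis ℝ F).equivFunL (γ z)) e :=
    contDiffAt_pi.2 fun i =>
      hγ ((ContinuousLinearMap.proj i).comp (Module.finBasis ℝ F).equivFunL.toContinuousLinearMap)
  simpa only [Function.comp_def, ContinuousLinearEquiv.symm_apply_apply] using
    (Module.finBasis ℝ F).equivFunL.symm.contDiff.contDiffAt.comp e hcoord

lemma isPlotAt_linear [FiniteDimensional ℝ E] (σ : E →ₗ[ℝ] V) (e : E) : IsPlotAt σ e := fun φ =>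
  (LinearMap.toContinuousLinearMap (φ.toLinearMap ∘ₗ σ)).contDiff.contDiffAt

lemma isPlotAt_line (p v : V) (t : ℝ) : IsPlotAt (fun t : ℝ => p + t • v) t :=
  (isPlotAt_const p t).add (.smul contDiffAt_id (isPlotAt_const v t))

section Smooth

variable {D : Set V} {K : Submodule ℝ V} {h : V → F} [FiniteDimensional ℝ F]

lemma PlotSmoothOn.contDiffAt_comp (hh : PlotSmoothOn D h) {γ : E → V} {e : E}
    (hγ : IsPlotAt γ e) (he : γ e ∈ D) : ContDiffAt ℝ ∞ (fun z => h (γ z)) e :=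
  (hh hγ he).contDiffAt

lemma PlotSmoothOn.differentiableAt_line (hh : PlotSmoothOn D h) {p v : V} {t : ℝ}
    (hp : p + t • v ∈ D) : DifferentiableAt ℝ (fun t : ℝ => h (p + t • v)) t :=
  (hh.contDiffAt_comp (isPlotAt_line p v t) hp).differentiableAt (by simp)

lemma PlotSmoothOn.lineDeriv_field (hh : PlotSmoothOn D h) {Z : V → V} (hZ : PlotSmoothOn D Z) :
    PlotSmoothOn D fun q => lineDeriv ℝ h q (Z q) := by
  intro E _ _ γ e hγ he
  have hplot : IsPlotAt (fun z : E × ℝ => γ z.1 + z.2 • Z (γ z.1)) (e, 0) :=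
    (hγ.comp (φ := Prod.fst) (f := (e, (0 : ℝ))) contDiffAt_fst).add
      (.smul contDiffAt_snd ((hZ hγ he).comp (φ := Prod.fst) (f := (e, (0 : ℝ))) contDiffAt_fst))
  have hsmooth := hh.contDiffAt_comp hplot (by simpa using he)
  have hfderiv : ContDiffAt ℝ ∞
      (fun z : E => fderiv ℝ (fun t : ℝ => h (γ z + t • Z (γ z))) 0) e :=
    ContDiffAt.fderiv (f := fun (z : E) (t : ℝ) => h (γ z + t • Z (γ z))) (g := fun _ => 0)
      (n := ∞) hsmooth contDiffAt_const (by simp)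
  exact isPlotAt_of_contDiffAt (hfderiv.clm_apply (contDiffAt_const (c := (1 : ℝ))))

lemma PlotSmoothOn.exists_hasFDerivAt [FiniteDimensional ℝ E] (hh : PlotSmoothOn D h) {p : V}
    (hp : p ∈ D) (σ : E →ₗ[ℝ] V) : ∃ L : E →L[ℝ] F,
      HasFDerivAt (fun z => h (p + σ z)) L 0 ∧ ∀ z, L z = lineDeriv ℝ h p (σ z) := by
  have hslice : DifferentiableAt ℝ (fun z => h (p + σ z)) 0 :=
    (hh.contDiffAt_comp ((isPlotAt_const p 0).add (isPlotAt_linear σ 0))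
      (by simpa using hp)).differentiableAt (by simp)
  refine ⟨_, hslice.hasFDerivAt, fun z => ?_⟩
  rw [← hslice.lineDeriv_eq_fderiv]
  simp only [lineDeriv, zero_add, map_smul]

lemma PlotSmoothOn.lineDeriv_add (hh : PlotSmoothOn D h) {p : V} (hp : p ∈ D) (v w : V) :
    lineDeriv ℝ h p (v + w) = lineDeriv ℝ h p v + lineDeriv ℝ h p w := by
  obtain ⟨L, -, hL⟩ := hh.exists_hasFDerivAt hp
    ((LinearMap.fst ℝ ℝ ℝ).smulRight v + (LinearMap.snd ℝ ℝ ℝ).smulRight w)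
  have hadd := L.map_add (1, 0) (0, 1)
  simpa [hL] using hadd

lemma PlotSmoothOn.eq_of_lineDeriv_eq_zero (hh : PlotSmoothOn D h) {p v : V}
    (hD : ∀ t ∈ Set.Icc (0 : ℝ) 1, p + t • v ∈ D)
    (hzero : ∀ t ∈ Set.Icc (0 : ℝ) 1, lineDeriv ℝ h (p + t • v) v = 0) :
    h (p + v) = h p := by
  have hderiv (t : ℝ) (ht : t ∈ Set.Icc (0 : ℝ) 1) :
      HasDerivAt (fun t : ℝ => h (p + t • v)) 0 t := by
    have hshift : lineDeriv ℝ h (p + t • v) v = deriv (fun s : ℝ => h (p + s • v)) t := by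
      have hcomp := deriv_comp_const_add (fun s : ℝ => h (p + s • v)) t 0
      simpa only [lineDeriv, add_assoc, ← add_smul, add_zero] using hcomp
    rw [← hzero t ht, hshift]
    exact (hh.differentiableAt_line (hD t ht)).hasDerivAt
  simpa using constant_of_has_deriv_right_zero
    (fun t ht => (hderiv t ht).continuousAt.continuousWithinAt)
    (fun t ht => (hderiv t (Set.Ico_subset_Icc_self ht)).hasDerivWithinAt) 1 (by simp)

end Smooth

section Order

variable {D : Set V} {K : Submodule ℝ V} {h : V → F}

lemma lineDeriv_congr_of_plotOpen (hD : PlotOpen D) {g : V → F} (hgh : Set.EqOn g h D) {p : V}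
    (hp : p ∈ D) (v : V) : lineDeriv ℝ g p v = lineDeriv ℝ h p v :=
  EventuallyEq.deriv_eq <|
    (hD (isPlotAt_line p v 0) (by simpa using hp)).mono fun _ ht => hgh ht

lemma InvariantOn.lineDeriv_eq (hh : InvariantOn D K h) (hD : PlotOpen D) {p q v w : V}
    (hp : p ∈ D) (hq : q ∈ D) (hpq : p ≡ q [SMOD K]) (hvw : v ≡ w [SMOD K]) :
    lineDeriv ℝ h p v = lineDeriv ℝ h q w := by
  refine EventuallyEq.deriv_eq ?_
  filter_upwards [hD (isPlotAt_line p v 0) (by simpa using hp),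
    hD (isPlotAt_line q w 0) (by simpa using hq)] with t ht₁ ht₂
  exact hh ht₁ ht₂ (hpq.add (hvw.smul t))

omit [TopologicalSpace V] in
lemma exists_linearMap_section {B : Type*} [AddCommGroup B] [Module ℝ B] (π : V →ₗ[ℝ] B) :
    ∃ σ : B →ₗ[ℝ] V, ∀ v, π (σ (π v)) = π v := by
  obtain ⟨σ₀, hσ₀⟩ := π.rangeRestrict.exists_rightInverse_of_surjective π.range_rangeRestrict
  obtain ⟨σ, hσ⟩ := σ₀.exists_extend
  refine ⟨σ, fun v => ?_⟩
  have hσv : σ (π v) = σ₀ (π.rangeRestrict v) := LinearMap.congr_fun hσ (π.rangeRestrict v)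
  rw [hσv]
  exact congrArg Subtype.val (LinearMap.congr_fun hσ₀ (π.rangeRestrict v))

/-- The chain rule along a curve needs its velocity only in the coordinates `h` depends on. -/
lemma PlotSmoothOn.hasDerivAt_comp {B : Type} [NormedAddCommGroup B] [NormedSpace ℝ B]
    [FiniteDimensional ℝ B] [FiniteDimensional ℝ F] {π : V →ₗ[ℝ] B} (hh : PlotSmoothOn D h)
    (hD : PlotOpen D) (hinv : InvariantOn D π.ker h) {γ : ℝ → V} {v : V} (hγ : IsPlotAt γ 0)
    (h0 : γ 0 ∈ D) (hv : HasDerivAt (fun t => π (γ t)) (π v) 0) :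
    HasDerivAt (fun t => h (γ t)) (lineDeriv ℝ h (γ 0) v) 0 := by
  obtain ⟨σ, hσ⟩ := exists_linearMap_section π
  obtain ⟨L, hL, hLσ⟩ := hh.exists_hasFDerivAt h0 σ
  have hdisp : HasDerivAt (fun t => π (γ t - γ 0)) (π v) 0 := by
    simpa only [map_sub] using hv.sub_const (π (γ 0))
  have hslice : ∀ᶠ z in 𝓝 0, γ 0 + σ z ∈ D :=
    hD ((isPlotAt_const (γ 0) 0).add (isPlotAt_linear σ 0)) (by simpa using h0)
  have hdisp0 : Tendsto (fun t => π (γ t - γ 0)) (𝓝 0) (𝓝 0) := by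
    simpa using hdisp.continuousAt.tendsto
  have hcomp := hL.comp_hasDerivAt_of_eq 0 hdisp (by simp)
  have hline : lineDeriv ℝ h (γ 0) (σ (π v)) = lineDeriv ℝ h (γ 0) v :=
    hinv.lineDeriv_eq hD h0 h0 .rfl (by simp [SModEq.sub_mem, hσ])
  rw [hLσ, hline] at hcomp
  refine hcomp.congr_of_eventuallyEq ?_
  filter_upwards [hD hγ h0, hdisp0.eventually hslice] with t ht hts
  exact hinv ht hts (by simp [SModEq.sub_mem, hσ])

end Order

lemma lineDeriv_lineDeriv_comm {H : E → F} {e : E} (hH : ContDiffAt ℝ ∞ H e) (v w : E) :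
    lineDeriv ℝ (fun z => lineDeriv ℝ H z v) e w
      = lineDeriv ℝ (fun z => lineDeriv ℝ H z w) e v := by
  have hdiff : ∀ᶠ z in 𝓝 e, DifferentiableAt ℝ H z :=
    ((hH.of_le (m := 1) (mod_cast le_top)).eventually (by simp)).mono
      fun z hz => hz.differentiableAt (by simp)
  have hsecond : DifferentiableAt ℝ (fderiv ℝ H) e :=
    (hH.fderiv_right (m := ∞) (by simp)).differentiableAt (by simp)
  have hiter (v w : E) :
      lineDeriv ℝ (fun z => lineDeriv ℝ H z v) e w = fderiv ℝ (fderiv ℝ H) e w v := by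
    have heq : (fun z => lineDeriv ℝ H z v) =ᶠ[𝓝 e] fun z => fderiv ℝ H z v :=
      hdiff.mono fun z hz => hz.lineDeriv_eq_fderiv
    rw [heq.lineDeriv_eq,
      (hsecond.clm_apply (differentiableAt_const v)).lineDeriv_eq_fderiv,
      fderiv_clm_apply hsecond (differentiableAt_const v)]
    simp
  rw [hiter, hiter]
  exact (hH.isSymmSndFDerivAt (by simpa using WithTop.coe_le_coe.2 (le_top : (2 : ℕ∞) ≤ ⊤))).eq w v

/-- If `X (p + t • Y p) = X p + t • Z` and `Y (p + t • X p) = Y p + t • Z`, then the mixed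
derivatives of `h` along `X` and `Y` are those of `h` on the surface
`p + r • X p + s • Y p + (r * s) • Z`. -/
lemma PlotSmoothOn.lineDeriv_lineDeriv_comm [FiniteDimensional ℝ F] {D : Set V} {h : V → F}
    (hh : PlotSmoothOn D h) {p : V} (hp : p ∈ D) {X Y : V → V} {Z : V}
    (hX : ∀ t : ℝ, X (p + t • Y p) = X p + t • Z) (hY : ∀ t : ℝ, Y (p + t • X p) = Y p + t • Z) :
    lineDeriv ℝ (fun q => lineDeriv ℝ h q (Y q)) p (X p)
      = lineDeriv ℝ (fun q => lineDeriv ℝ h q (X q)) p (Y p) := by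
  let surface : ℝ × ℝ → V := fun z => p + z.1 • X p + z.2 • Y p + (z.1 * z.2) • Z
  have hsurface : IsPlotAt surface (0, 0) :=
    (((isPlotAt_const p _).add (.smul contDiffAt_fst (isPlotAt_const (X p) _))).add
      (.smul contDiffAt_snd (isPlotAt_const (Y p) _))).add
      (.smul (contDiffAt_fst.mul contDiffAt_snd) (isPlotAt_const Z _))
  have hcomm := SDeform.lineDeriv_lineDeriv_comm
    (hh.contDiffAt_comp hsurface (by simpa [surface] using hp)) (0, 1) (1, 0)
  have hinnerY (r : ℝ) : lineDeriv ℝ (fun z => h (surface z)) ((0, 0) + r • (1, 0)) (0, 1)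
      = lineDeriv ℝ h (p + r • X p) (Y (p + r • X p)) := by
    simp [lineDeriv, surface, hY, smul_add, smul_smul, mul_comm, add_assoc]
  have hinnerX (s : ℝ) : lineDeriv ℝ (fun z => h (surface z)) ((0, 0) + s • (0, 1)) (1, 0)
      = lineDeriv ℝ h (p + s • Y p) (X (p + s • Y p)) := by
    simp [lineDeriv, surface, hX, smul_add, smul_smul, add_left_comm, add_assoc]
  change deriv (fun r : ℝ => lineDeriv ℝ h (p + r • X p) (Y (p + r • X p))) 0
    = deriv (fun s : ℝ => lineDeriv ℝ h (p + s • Y p) (X (p + s • Y p))) 0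
  simp only [← hinnerY, ← hinnerX]
  exact hcomm

end Plots

/-- The two independent variables. The system is symmetric under `(x, u, η₁) ↔ (y, v, η₂)`; each
axis carries its own dependent variable, `u` for the `x`-axis and `v` for the `y`-axis. -/
inductive Axis
  | x
  | y
deriving DecidableEq

/-- The other axis. -/
def Axis.other : Axis → Axis
  | .x => .y
  | .y => .x

/-- The coordinates on the jet space. `fibre a m n` is the derivative of the dependent variable of
the axis `a`, taken `m` times along `a` and `n` times along the other axis: `fibre .x m n` is
`u_{mn}` and `fibre .y m n` is `v_{nm}`. -/
inductive JetCoord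
  | base (a : Axis)
  | fibre (a : Axis) (m n : ℕ)

namespace JetCoord

/-- One more than the order of the derivative, and zero for the independent variables. -/
def level : JetCoord → ℕ
  | base _ => 0
  | fibre _ m n => m + n + 1

/-- The coordinates which the system leaves free; the remaining ones are `u_{i,j+2}` and
`v_{i+2,j}`. -/
def IsParametric : JetCoord → Prop
  | base _ => True
  | fibre _ _ n => n < 2

/-- All coordinates up to a given level. -/
def levelLE (n : ℕ) : Set JetCoord := {c | c.level ≤ n}

lemma mem_levelLE {n : ℕ} {c : JetCoord} : c ∈ levelLE n ↔ c.level ≤ n := .rfl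

lemma levelLE_mono {m n : ℕ} (hmn : m ≤ n) : levelLE m ⊆ levelLE n := fun _ hc => hc.trans hmn

lemma finite_levelLE (n : ℕ) : (levelLE n).Finite := by
  refine ((Set.finite_range fun b : Bool => base (cond b .x .y)).union
    (Set.finite_range fun z : Bool × Fin (n + 1) × Fin (n + 1) =>
      fibre (cond z.1 .x .y) z.2.1 z.2.2)).subset ?_
  rintro (a | ⟨a, i, j⟩) hc
  · exact .inl (by cases a <;> simp)
  · have hij : i + j + 1 ≤ n := hc
    refine .inr ⟨(match a with | .x => true | .y => false, ⟨i, by omega⟩, ⟨j, by omega⟩), ?_⟩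
    cases a <;> rfl

end JetCoord

open JetCoord

lemma Axis.eq_or_eq_other (a b : Axis) : b = a ∨ b = a.other := by
  cases a <;> cases b <;> simp [Axis.other]

/-- The coordinate functions as continuous linear functionals. -/
def coord : JetCoord → Jet →L[ℝ] ℝ
  | base .x => .fst ℝ _ _
  | base .y => .comp (.fst ℝ _ _) (.snd ℝ _ _)
  | fibre .x m n => .comp (.proj n) (.comp (.proj m) (.comp (.fst ℝ _ _)
      (.comp (.snd ℝ _ _) (.snd ℝ _ _))))
  | fibre .y m n => .comp (.proj m) (.comp (.proj n) (.comp (.snd ℝ _ _)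
      (.comp (.snd ℝ _ _) (.snd ℝ _ _))))

/-- The jet with prescribed coordinates. -/
def ofCoord (g : JetCoord → ℝ) : Jet :=
  (g (base .x), g (base .y), fun i j => g (fibre .x i j), fun i j => g (fibre .y j i))

@[simp]
lemma coord_ofCoord (g : JetCoord → ℝ) (c : JetCoord) : coord c (ofCoord g) = g c := by
  rcases c with (_ | _) | ⟨_ | _, _, _⟩ <;> rfl

lemma jet_ext {p q : Jet} (h : ∀ c, coord c p = coord c q) : p = q :=
  Prod.ext (h (base .x)) <| Prod.ext (h (base .y)) <| Prod.ext
    (funext fun i => funext fun j => h (fibre .x i j))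
    (funext fun i => funext fun j => h (fibre .y j i))

lemma isPlotAt_jet {E : Type} [NormedAddCommGroup E] [NormedSpace ℝ E] {γ : E → Jet} {e : E}
    (hγ : ∀ c, ContDiffAt ℝ ∞ (fun z => coord c (γ z)) e) : IsPlotAt γ e :=
  .prodMk (isPlotAt_of_contDiffAt (hγ (base .x))) <|
    .prodMk (isPlotAt_of_contDiffAt (hγ (base .y))) <| .prodMk
      (isPlotAt_pi fun i => isPlotAt_pi fun j => isPlotAt_of_contDiffAt (hγ (fibre .x i j)))
      (isPlotAt_pi fun i => isPlotAt_pi fun j => isPlotAt_of_contDiffAt (hγ (fibre .y j i)))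

/-- The projection to the coordinates in `S`. -/
def coords (S : Set JetCoord) : Jet →ₗ[ℝ] (S → ℝ) :=
  LinearMap.pi fun c => (coord c).toLinearMap

lemma sModEq_ker_coords {S : Set JetCoord} {p q : Jet} :
    p ≡ q [SMOD (coords S).ker] ↔ ∀ c ∈ S, coord c p = coord c q := by
  simp [SModEq.sub_mem, coords, funext_iff, sub_eq_zero]

lemma ker_coords_anti {S T : Set JetCoord} (hST : S ⊆ T) : (coords T).ker ≤ (coords S).ker :=
  fun p hp => by
    rw [← SModEq.zero, sModEq_ker_coords] at hp ⊢
    exact fun c hc => hp c (hST hc)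

/-- The total derivative fields `jetFieldX` and `jetFieldY`. -/
def totalField : Axis → Jet → Jet
  | .x => jetFieldX
  | .y => jetFieldY

/-- The total derivatives `jetDx` and `jetDy`. -/
def total : Axis → (Jet → ℝ) → Jet → ℝ
  | .x => jetDx
  | .y => jetDy

lemma total_apply (a : Axis) (g : Jet → ℝ) (p : Jet) :
    total a g p = lineDeriv ℝ g p (totalField a p) := by
  cases a <;> rfl

/-- The `m`-fold total derivative along `a` and `n`-fold total derivative along the other axis,
in the order `D_x^i D_y^j` of the prolonged system. -/
def totalIter : Axis → ℕ → ℕ → (Jet → ℝ) → Jet → ℝ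
  | .x, m, n => fun g => jetDx^[m] (jetDy^[n] g)
  | .y, m, n => fun g => jetDx^[n] (jetDy^[m] g)

lemma coord_base_totalField (a b : Axis) (p q : Jet) :
    coord (base a) (totalField b p) = coord (base a) (totalField b q) := by
  cases a <;> cases b <;> rfl

@[simp]
lemma coord_fibre_totalField (a : Axis) (m n : ℕ) (p : Jet) :
    coord (fibre a m n) (totalField a p) = coord (fibre a (m + 1) n) p := by
  cases a <;> rfl

@[simp]
lemma coord_fibre_totalField_other (a : Axis) (m n : ℕ) (p : Jet) :
    coord (fibre a m n) (totalField a.other p) = coord (fibre a m (n + 1)) p := by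
  cases a <;> rfl

lemma totalField_sModEq {n : ℕ} {p q : Jet} (h : p ≡ q [SMOD (coords (levelLE (n + 1))).ker])
    (a : Axis) : totalField a p ≡ totalField a q [SMOD (coords (levelLE n)).ker] := by
  rw [sModEq_ker_coords] at h ⊢
  rintro (b | ⟨b, i, j⟩) hc
  · exact coord_base_totalField b a p q
  · obtain rfl | rfl := b.eq_or_eq_other a
    · simpa using h (fibre a (i + 1) j) (by simp only [mem_levelLE, level] at hc ⊢; omega)
    · simpa using h (fibre b i (j + 1)) (by simp only [mem_levelLE, level] at hc ⊢; omega)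

lemma plotSmoothOn_totalField (a : Axis) (D : Set Jet) : PlotSmoothOn D (totalField a) := by
  intro E _ _ γ e hγ _
  refine isPlotAt_jet ?_
  rintro (b | ⟨b, i, j⟩)
  · simpa only [coord_base_totalField b a _ 0] using contDiffAt_const
  · obtain rfl | rfl := b.eq_or_eq_other a
    · simpa using hγ (coord (fibre a (i + 1) j))
    · simpa using hγ (coord (fibre b i (j + 1)))

section Iterates

variable {D : Set Jet} {g h : Jet → ℝ}

lemma PlotSmoothOn.total (hg : PlotSmoothOn D g) (a : Axis) : PlotSmoothOn D (total a g) := by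
  simpa only [← total_apply] using hg.lineDeriv_field (plotSmoothOn_totalField a D)

lemma PlotSmoothOn.iterate_total (hg : PlotSmoothOn D g) (a : Axis) (k : ℕ) :
    PlotSmoothOn D ((SDeform.total a)^[k] g) := by
  induction k with
  | zero => exact hg
  | succ k ih => simpa only [Function.iterate_succ_apply'] using ih.total a

lemma PlotSmoothOn.totalIter (hg : PlotSmoothOn D g) (a : Axis) (m n : ℕ) :
    PlotSmoothOn D (totalIter a m n g) := by
  cases a
  · exact (hg.iterate_total .y n).iterate_total .x m
  · exact (hg.iterate_total .y m).iterate_total .x n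

lemma InvariantOn.total (hD : PlotOpen D) {k : ℕ}
    (hg : InvariantOn D (coords (levelLE k)).ker g) (a : Axis) :
    InvariantOn D (coords (levelLE (k + 1))).ker (total a g) := by
  intro p hp q hq hpq
  rw [total_apply, total_apply]
  exact hg.lineDeriv_eq hD hp hq
    (hpq.mono (ker_coords_anti (levelLE_mono k.le_succ))) (totalField_sModEq hpq a)

lemma InvariantOn.iterate_total (hD : PlotOpen D) {k : ℕ}
    (hg : InvariantOn D (coords (levelLE k)).ker g) (a : Axis) (m : ℕ) :
    InvariantOn D (coords (levelLE (k + m))).ker ((SDeform.total a)^[m] g) := by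
  induction m with
  | zero => exact hg
  | succ m ih =>
    rw [Function.iterate_succ_apply']
    exact ih.total hD a

lemma InvariantOn.totalIter (hD : PlotOpen D) {k : ℕ}
    (hg : InvariantOn D (coords (levelLE k)).ker g) (a : Axis) (m n : ℕ) :
    InvariantOn D (coords (levelLE (k + (m + n)))).ker (totalIter a m n g) := by
  cases a
  · rw [add_comm m n, ← add_assoc]
    exact (hg.iterate_total hD .y n).iterate_total hD .x m
  · rw [← add_assoc]
    exact (hg.iterate_total hD .y m).iterate_total hD .x n

lemma jetDx_jetDy_comm (hg : PlotSmoothOn D g) : D.EqOn (jetDx (jetDy g)) (jetDy (jetDx g)) := by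
  intro p hp
  refine hg.lineDeriv_lineDeriv_comm hp (X := jetFieldX) (Y := jetFieldY)
    (Z := (0, 0, fun i j => ju (i + 1) (j + 1) p, fun i j => jv (i + 1) (j + 1) p))
    (fun t => ?_) (fun t => ?_) <;>
  ext <;> simp [jetFieldX, jetFieldY, ju, jv]

lemma total_congr (hD : PlotOpen D) (hgh : D.EqOn g h) (a : Axis) :
    D.EqOn (total a g) (total a h) := by
  intro p hp
  rw [total_apply, total_apply, lineDeriv_congr_of_plotOpen hD hgh hp]

lemma jetDy_iterate_jetDx (hD : PlotOpen D) (hg : PlotSmoothOn D g) (m : ℕ) :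
    D.EqOn (jetDy (jetDx^[m] g)) (jetDx^[m] (jetDy g)) := by
  induction m with
  | zero => exact fun _ _ => rfl
  | succ m ih =>
    simp only [Function.iterate_succ_apply']
    exact (jetDx_jetDy_comm (hg.iterate_total .x m)).symm.trans (total_congr hD ih .x)

lemma total_totalIter (hD : PlotOpen D) (hg : PlotSmoothOn D g) (a : Axis) (m n : ℕ) :
    D.EqOn (total a (totalIter a m n g)) (totalIter a (m + 1) n g) := by
  cases a
  · simp only [totalIter, Function.iterate_succ_apply']
    exact fun _ _ => rfl
  · simp only [totalIter, Function.iterate_succ_apply' jetDy]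
    exact jetDy_iterate_jetDx hD (hg.iterate_total .y m) n

lemma total_other_totalIter (hD : PlotOpen D) (hg : PlotSmoothOn D g) (a : Axis) (m n : ℕ) :
    D.EqOn (total a.other (totalIter a m n g)) (totalIter a m (n + 1) g) := by
  cases a
  · simp only [totalIter, Function.iterate_succ_apply' jetDy]
    exact jetDy_iterate_jetDx hD (hg.iterate_total .y n) m
  · simp only [totalIter, Function.iterate_succ_apply' jetDx]
    exact fun _ _ => rfl

lemma PlotSmoothOn.hasDerivAt_comp_of_coord (hD : PlotOpen D) (hg : PlotSmoothOn D g)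
    {S : Set JetCoord} (hS : S.Finite) (hinv : InvariantOn D (coords S).ker g) {γ : ℝ → Jet}
    {v : Jet} (hγ : IsPlotAt γ 0) (h0 : γ 0 ∈ D)
    (hv : ∀ c ∈ S, HasDerivAt (fun t => coord c (γ t)) (coord c v) 0) :
    HasDerivAt (fun t => g (γ t)) (lineDeriv ℝ g (γ 0) v) 0 := by
  have := hS.fintype
  exact hg.hasDerivAt_comp hD hinv hγ h0 (hasDerivAt_pi.2 fun c => hv c c.2)

end Iterates

section Linear

variable {D : Set Jet} {g h : Jet → ℝ}

lemma total_sub (hg : PlotSmoothOn D g) (hh : PlotSmoothOn D h) (a : Axis) :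
    D.EqOn (total a (g - h)) (total a g - total a h) := by
  intro p hp
  simp only [total_apply, Pi.sub_apply]
  exact deriv_fun_sub (hg.differentiableAt_line (by simpa using hp))
    (hh.differentiableAt_line (by simpa using hp))

lemma iterate_total_sub (hD : PlotOpen D) (hg : PlotSmoothOn D g) (hh : PlotSmoothOn D h)
    (a : Axis) (k : ℕ) :
    D.EqOn ((total a)^[k] (g - h)) ((total a)^[k] g - (total a)^[k] h) := by
  induction k with
  | zero => exact fun _ _ => rfl
  | succ k ih =>
    simp only [Function.iterate_succ_apply']
    exact (total_congr hD ih a).trans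
      (total_sub (hg.iterate_total a k) (hh.iterate_total a k) a)

lemma iterate_total_congr (hD : PlotOpen D) (hgh : D.EqOn g h) (a : Axis) (k : ℕ) :
    D.EqOn ((total a)^[k] g) ((total a)^[k] h) := by
  induction k with
  | zero => exact hgh
  | succ k ih => simpa only [Function.iterate_succ_apply'] using total_congr hD ih a

lemma totalIter_sub (hD : PlotOpen D) (hg : PlotSmoothOn D g) (hh : PlotSmoothOn D h)
    (a : Axis) (m n : ℕ) :
    D.EqOn (totalIter a m n (g - h)) (totalIter a m n g - totalIter a m n h) := by
  cases a
  · exact (iterate_total_congr hD (iterate_total_sub hD hg hh .y n) .x m).trans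
      (iterate_total_sub hD (hg.iterate_total .y n) (hh.iterate_total .y n) .x m)
  · exact (iterate_total_congr hD (iterate_total_sub hD hg hh .y m) .x n).trans
      (iterate_total_sub hD (hg.iterate_total .y m) (hh.iterate_total .y m) .x n)

lemma plotSmoothOn_coord (c : JetCoord) (D : Set Jet) : PlotSmoothOn D (coord c) :=
  fun _ _ _ _ _ hγ _ => hγ.map (coord c)

lemma lineDeriv_coord (c : JetCoord) (p v : Jet) : lineDeriv ℝ (coord c) p v = coord c v := by
  simp [lineDeriv]

lemma iterate_total_coord (a : Axis) (k m n : ℕ) :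
    (total a)^[k] (coord (fibre a m n)) = coord (fibre a (m + k) n) := by
  induction k with
  | zero => rfl
  | succ k ih =>
    funext p
    rw [Function.iterate_succ_apply', ih, total_apply, lineDeriv_coord, coord_fibre_totalField]
    rfl

lemma iterate_total_other_coord (a : Axis) (k m n : ℕ) :
    (total a.other)^[k] (coord (fibre a m n)) = coord (fibre a m (n + k)) := by
  induction k with
  | zero => rfl
  | succ k ih =>
    funext p
    rw [Function.iterate_succ_apply', ih, total_apply, lineDeriv_coord,
      coord_fibre_totalField_other]
    rfl

lemma totalIter_coord (a : Axis) (m n k l : ℕ) :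
    totalIter a m n (coord (fibre a k l)) = coord (fibre a (k + m) (l + n)) := by
  cases a
  · exact (congrArg jetDx^[m] (iterate_total_other_coord .x n k l)).trans
      (iterate_total_coord .x m k (l + n))
  · exact (congrArg jetDx^[n] (iterate_total_coord .y m k l)).trans
      (iterate_total_other_coord .y n (k + m) l)

end Linear

/-- The standing assumptions on the data of the system. -/
structure SmoothData (η₁ η₂ : ℝ → ℝ) (I J : Set ℝ) : Prop where
  isOpen_left : IsOpen I
  isOpen_right : IsOpen J
  contDiffOn_left : ContDiffOn ℝ ∞ η₁ I
  contDiffOn_right : ContDiffOn ℝ ∞ η₂ J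

/-- The right-hand sides of the equations for `u_yy` and `v_xx`. -/
def rhs (η₁ η₂ : ℝ → ℝ) : Axis → Jet → ℝ
  | .x => fun p => (1 / 2 * deriv η₁ (jx p) * jv 0 0 p ^ 2 * jv 1 0 p
      + 1 / 2 * deriv η₂ (jy p) * ju 0 0 p * jv 0 0 p * ju 0 1 p
      + (η₁ (jx p) - η₂ (jy p)) * ju 0 0 p * ju 0 1 p * jv 0 1 p
      + ju 0 0 p ^ 2 * jv 0 0 p ^ 3) / (ju 0 0 p * jv 0 0 p * (η₁ (jx p) - η₂ (jy p)))
  | .y => fun p => (1 / 2 * deriv η₁ (jx p) * ju 0 0 p * jv 0 0 p * jv 1 0 p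
      + 1 / 2 * deriv η₂ (jy p) * ju 0 0 p ^ 2 * ju 0 1 p
      + (η₂ (jy p) - η₁ (jx p)) * jv 0 0 p * jv 1 0 p * ju 1 0 p
      + ju 0 0 p ^ 3 * jv 0 0 p ^ 2) / (ju 0 0 p * jv 0 0 p * (η₂ (jy p) - η₁ (jx p)))

/-- The value which the prolonged system prescribes for `fibre a m (n + 2)`. -/
def prolong (η₁ η₂ : ℝ → ℝ) (a : Axis) (m n : ℕ) : Jet → ℝ := totalIter a m n (rhs η₁ η₂ a)

/-- Replace every coordinate which is not parametric by the value the prolonged system prescribes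
for it. The points of the equation are the fixed points. -/
def eqnStep (η₁ η₂ : ℝ → ℝ) (p : Jet) : Jet :=
  ofCoord fun
    | fibre a m (n + 2) => prolong η₁ η₂ a m n p
    | c => coord c p

/-- The point of the equation with the same parametric coordinates as `p`. A prescribed coordinate
involves only coordinates of lower level, so finitely many steps determine each coordinate. -/
def jetNormal (η₁ η₂ : ℝ → ℝ) (p : Jet) : Jet :=
  ofCoord fun c => coord c ((eqnStep η₁ η₂)^[c.level] p)

/-- The coordinates of level at most `M` which are parametric or of level at most `k`: those which
`k` steps of `eqnStep` determine. -/
def knownLE (k M : ℕ) : Set JetCoord := {c | c.level ≤ M ∧ (c.IsParametric ∨ c.level ≤ k)}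

lemma knownLE_mono {k l : ℕ} (hkl : k ≤ l) (M : ℕ) : knownLE k M ⊆ knownLE l M :=
  fun _ hc => ⟨hc.1, hc.2.imp_right (·.trans hkl)⟩

lemma knownLE_self (M : ℕ) : knownLE M M = levelLE M :=
  Set.ext fun _ => ⟨fun hc => hc.1, fun hc => ⟨hc, .inr hc⟩⟩

section System

variable {η₁ η₂ : ℝ → ℝ} {I J : Set ℝ}

lemma coord_eqnStep_fibre (a : Axis) (m n : ℕ) (p : Jet) :
    coord (fibre a m (n + 2)) (eqnStep η₁ η₂ p) = prolong η₁ η₂ a m n p := by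
  rw [eqnStep, coord_ofCoord]

lemma coord_eqnStep_of_isParametric {c : JetCoord} (hc : c.IsParametric) (p : Jet) :
    coord c (eqnStep η₁ η₂ p) = coord c p := by
  rw [eqnStep, coord_ofCoord]
  rcases c with a | ⟨a, m, _ | _ | n⟩
  · rfl
  · rfl
  · rfl
  · exact absurd hc (by simp [IsParametric])

lemma eqnStep_eq_self_iff {p : Jet} :
    eqnStep η₁ η₂ p = p ↔ ∀ a m n, coord (fibre a m (n + 2)) p = prolong η₁ η₂ a m n p := by
  refine ⟨fun h a m n => ?_, fun h => jet_ext fun c => ?_⟩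
  · rw [← coord_eqnStep_fibre, h]
  · rcases c with a | ⟨a, m, _ | _ | n⟩
    · exact coord_eqnStep_of_isParametric (c := base a) trivial p
    · exact coord_eqnStep_of_isParametric (c := fibre a m 0) Nat.zero_lt_two p
    · exact coord_eqnStep_of_isParametric (c := fibre a m 1) Nat.one_lt_two p
    · rw [coord_eqnStep_fibre, h]

lemma eqnStep_sModEq_self (M : ℕ) (p : Jet) :
    eqnStep η₁ η₂ p ≡ p [SMOD (coords (knownLE 0 M)).ker] := by
  refine sModEq_ker_coords.2 fun c hc => coord_eqnStep_of_isParametric (hc.2.elim id ?_) p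
  rcases c with a | ⟨a, m, n⟩
  · exact fun _ => trivial
  · simp [level]

lemma iterate_eqnStep_sModEq_self (k M : ℕ) (p : Jet) :
    (eqnStep η₁ η₂)^[k] p ≡ p [SMOD (coords (knownLE 0 M)).ker] := by
  induction k with
  | zero => rfl
  | succ k ih =>
    rw [Function.iterate_succ_apply']
    exact (eqnStep_sModEq_self M _).trans ih

lemma jetNormal_sModEq_self (M : ℕ) (p : Jet) :
    jetNormal η₁ η₂ p ≡ p [SMOD (coords (knownLE 0 M)).ker] := by
  refine sModEq_ker_coords.2 fun c hc => ?_
  rw [jetNormal, coord_ofCoord]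
  exact sModEq_ker_coords.1 (iterate_eqnStep_sModEq_self c.level M p) c hc

lemma mem_jetDomain_of_sModEq {p q : Jet} (h : p ≡ q [SMOD (coords (knownLE 0 1)).ker])
    (hq : q ∈ jetDomain η₁ η₂ I J) : p ∈ jetDomain η₁ η₂ I J := by
  rw [sModEq_ker_coords] at h
  have hx : jx p = jx q := h (base .x) ⟨Nat.zero_le _, .inl trivial⟩
  have hy : jy p = jy q := h (base .y) ⟨Nat.zero_le _, .inl trivial⟩
  have hu : ju 0 0 p = ju 0 0 q := h (fibre .x 0 0) ⟨le_rfl, .inl Nat.zero_lt_two⟩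
  have hv : jv 0 0 p = jv 0 0 q := h (fibre .y 0 0) ⟨le_rfl, .inl Nat.zero_lt_two⟩
  simpa only [jetDomain, Set.mem_ofPred_eq, hx, hy, hu, hv] using hq

lemma iterate_eqnStep_mem {p : Jet} (hp : p ∈ jetDomain η₁ η₂ I J) (k : ℕ) :
    (eqnStep η₁ η₂)^[k] p ∈ jetDomain η₁ η₂ I J :=
  mem_jetDomain_of_sModEq (iterate_eqnStep_sModEq_self k 1 p) hp

lemma jetNormal_mem_jetDomain {p : Jet} (hp : p ∈ jetDomain η₁ η₂ I J) :
    jetNormal η₁ η₂ p ∈ jetDomain η₁ η₂ I J :=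
  mem_jetDomain_of_sModEq (jetNormal_sModEq_self 1 p) hp

lemma invariantOn_rhs (a : Axis) (D : Set Jet) :
    InvariantOn D (coords (levelLE 2)).ker (rhs η₁ η₂ a) := by
  intro p _ q _ h
  rw [sModEq_ker_coords] at h
  have hx : jx p = jx q := h (base .x) (Nat.zero_le _)
  have hy : jy p = jy q := h (base .y) (Nat.zero_le _)
  have hu : ju 0 0 p = ju 0 0 q := h (fibre .x 0 0) (show 1 ≤ 2 from one_le_two)
  have hv : jv 0 0 p = jv 0 0 q := h (fibre .y 0 0) (show 1 ≤ 2 from one_le_two)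
  have hux : ju 1 0 p = ju 1 0 q := h (fibre .x 1 0) (Nat.le_refl 2)
  have huy : ju 0 1 p = ju 0 1 q := h (fibre .x 0 1) (Nat.le_refl 2)
  have hvx : jv 1 0 p = jv 1 0 q := h (fibre .y 0 1) (Nat.le_refl 2)
  have hvy : jv 0 1 p = jv 0 1 q := h (fibre .y 1 0) (Nat.le_refl 2)
  cases a <;> simp only [rhs, hx, hy, hu, hv, hux, huy, hvx, hvy]

lemma contDiffAt_deriv {f : ℝ → ℝ} {x : ℝ} (hf : ContDiffAt ℝ ∞ f x) :
    ContDiffAt ℝ ∞ (deriv f) x :=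
  (hf.fderiv_right (m := ∞) (by simp)).clm_apply contDiffAt_const

namespace SmoothData

variable (hd : SmoothData η₁ η₂ I J)
include hd

lemma contDiffAt_left {x : ℝ} (hx : x ∈ I) : ContDiffAt ℝ ∞ η₁ x :=
  hd.contDiffOn_left.contDiffAt (hd.isOpen_left.mem_nhds hx)

lemma contDiffAt_right {y : ℝ} (hy : y ∈ J) : ContDiffAt ℝ ∞ η₂ y :=
  hd.contDiffOn_right.contDiffAt (hd.isOpen_right.mem_nhds hy)

lemma plotOpen_jetDomain : PlotOpen (jetDomain η₁ η₂ I J) := by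
  intro E _ _ γ e hγ he
  have hcoord (c : JetCoord) : ContinuousAt (fun z => coord c (γ z)) e :=
    (hγ (coord c)).continuousAt
  have hη₁ : ContinuousAt (fun z => η₁ (jx (γ z))) e :=
    (hd.contDiffAt_left he.1).continuousAt.comp (f := fun z => jx (γ z)) (hcoord (base .x))
  have hη₂ : ContinuousAt (fun z => η₂ (jy (γ z))) e :=
    (hd.contDiffAt_right he.2.1).continuousAt.comp (f := fun z => jy (γ z)) (hcoord (base .y))
  filter_upwards [(hcoord (base .x)).eventually_mem (hd.isOpen_left.mem_nhds he.1),
    (hcoord (base .y)).eventually_mem (hd.isOpen_right.mem_nhds he.2.1),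
    (hη₁.sub hη₂).eventually_ne (sub_ne_zero.2 he.2.2.1),
    (hcoord (fibre .x 0 0)).eventually_ne he.2.2.2.1,
    (hcoord (fibre .y 0 0)).eventually_ne he.2.2.2.2] with z hx hy hη hu hv
  exact ⟨hx, hy, sub_ne_zero.1 hη, hu, hv⟩

lemma plotSmoothOn_rhs (a : Axis) : PlotSmoothOn (jetDomain η₁ η₂ I J) (rhs η₁ η₂ a) := by
  intro E _ _ γ e hγ he
  have hx : ContDiffAt ℝ ∞ (fun z => jx (γ z)) e := hγ (coord (base .x))
  have hy : ContDiffAt ℝ ∞ (fun z => jy (γ z)) e := hγ (coord (base .y))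
  have hu : ContDiffAt ℝ ∞ (fun z => ju 0 0 (γ z)) e := hγ (coord (fibre .x 0 0))
  have hux : ContDiffAt ℝ ∞ (fun z => ju 1 0 (γ z)) e := hγ (coord (fibre .x 1 0))
  have huy : ContDiffAt ℝ ∞ (fun z => ju 0 1 (γ z)) e := hγ (coord (fibre .x 0 1))
  have hv : ContDiffAt ℝ ∞ (fun z => jv 0 0 (γ z)) e := hγ (coord (fibre .y 0 0))
  have hvx : ContDiffAt ℝ ∞ (fun z => jv 1 0 (γ z)) e := hγ (coord (fibre .y 0 1))
  have hvy : ContDiffAt ℝ ∞ (fun z => jv 0 1 (γ z)) e := hγ (coord (fibre .y 1 0))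
  have hη₁ : ContDiffAt ℝ ∞ (fun z => η₁ (jx (γ z))) e := (hd.contDiffAt_left he.1).comp e hx
  have hη₂ : ContDiffAt ℝ ∞ (fun z => η₂ (jy (γ z))) e := (hd.contDiffAt_right he.2.1).comp e hy
  have hη₁' : ContDiffAt ℝ ∞ (fun z => deriv η₁ (jx (γ z))) e :=
    (contDiffAt_deriv (hd.contDiffAt_left he.1)).comp (f := fun z => jx (γ z)) e hx
  have hη₂' : ContDiffAt ℝ ∞ (fun z => deriv η₂ (jy (γ z))) e :=
    (contDiffAt_deriv (hd.contDiffAt_right he.2.1)).comp (f := fun z => jy (γ z)) e hy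
  have hη := sub_ne_zero.2 he.2.2.1
  have hη' := sub_ne_zero.2 he.2.2.1.symm
  have huv := mul_ne_zero he.2.2.2.1 he.2.2.2.2
  refine isPlotAt_of_contDiffAt ?_
  cases a
  · exact (((((contDiffAt_const.mul hη₁').mul (hv.pow 2)).mul hvx).add
      ((((contDiffAt_const.mul hη₂').mul hu).mul hv).mul huy)).add
      ((((hη₁.sub hη₂).mul hu).mul huy).mul hvy) |>.add ((hu.pow 2).mul (hv.pow 3))).div
      ((hu.mul hv).mul (hη₁.sub hη₂)) (mul_ne_zero huv hη)
  · exact (((((contDiffAt_const.mul hη₁').mul hu).mul hv).mul hvx).add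
      (((contDiffAt_const.mul hη₂').mul (hu.pow 2)).mul huy) |>.add
      ((((hη₂.sub hη₁).mul hv).mul hvx).mul hux) |>.add ((hu.pow 3).mul (hv.pow 2))).div
      ((hu.mul hv).mul (hη₂.sub hη₁)) (mul_ne_zero huv hη')

end SmoothData

end System

section NormalForm

variable {η₁ η₂ : ℝ → ℝ} {I J : Set ℝ}

namespace SmoothData

variable (hd : SmoothData η₁ η₂ I J)
include hd

lemma plotSmoothOn_prolong (a : Axis) (m n : ℕ) :
    PlotSmoothOn (jetDomain η₁ η₂ I J) (prolong η₁ η₂ a m n) :=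
  (hd.plotSmoothOn_rhs a).totalIter a m n

lemma invariantOn_prolong (a : Axis) (m n : ℕ) :
    InvariantOn (jetDomain η₁ η₂ I J) (coords (levelLE (2 + (m + n)))).ker
      (prolong η₁ η₂ a m n) :=
  (invariantOn_rhs a _).totalIter hd.plotOpen_jetDomain a m n

lemma totalIter_coord_sub_rhs {p : Jet} (hp : p ∈ jetDomain η₁ η₂ I J) (a : Axis) (m n : ℕ) :
    totalIter a m n (coord (fibre a 0 2) - rhs η₁ η₂ a) p
      = coord (fibre a m (n + 2)) p - prolong η₁ η₂ a m n p := by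
  rw [totalIter_sub hd.plotOpen_jetDomain (plotSmoothOn_coord _ _) (hd.plotSmoothOn_rhs a) a m n
    hp, totalIter_coord, zero_add, add_comm 2 n]
  rfl

lemma mem_equationManifold_iff {p : Jet} :
    p ∈ equationManifold η₁ η₂ I J ↔ p ∈ jetDomain η₁ η₂ I J ∧ eqnStep η₁ η₂ p = p := by
  refine and_congr_right fun hp => ?_
  have hiff (a : Axis) (m n : ℕ) : totalIter a m n (coord (fibre a 0 2) - rhs η₁ η₂ a) p = 0 ↔
      coord (fibre a m (n + 2)) p = prolong η₁ η₂ a m n p := by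
    rw [hd.totalIter_coord_sub_rhs hp, sub_eq_zero]
  rw [eqnStep_eq_self_iff]
  constructor
  · rintro h (_ | _) m n
    · exact (hiff .x m n).1 (h m n).1
    · exact (hiff .y m n).1 (h n m).2
  · exact fun h i j => ⟨(hiff .x i j).2 (h .x i j), (hiff .y j i).2 (h .y j i)⟩

lemma eqnStep_sModEq {k M : ℕ} {p q : Jet} (hp : p ∈ jetDomain η₁ η₂ I J)
    (hq : q ∈ jetDomain η₁ η₂ I J) (h : p ≡ q [SMOD (coords (knownLE k M)).ker]) :
    eqnStep η₁ η₂ p ≡ eqnStep η₁ η₂ q [SMOD (coords (knownLE (k + 1) M)).ker] := by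
  refine sModEq_ker_coords.2 fun c hc => ?_
  by_cases hpar : c.IsParametric
  · rw [coord_eqnStep_of_isParametric hpar, coord_eqnStep_of_isParametric hpar]
    exact sModEq_ker_coords.1 h c ⟨hc.1, .inl hpar⟩
  rcases c with a | ⟨a, m, _ | _ | n⟩
  · exact absurd trivial hpar
  · exact absurd Nat.zero_lt_two hpar
  · exact absurd Nat.one_lt_two hpar
  · rw [coord_eqnStep_fibre, coord_eqnStep_fibre]
    refine hd.invariantOn_prolong a m n hp hq (h.mono (ker_coords_anti fun d hdl => ?_))
    have hlevel : m + (n + 2) + 1 ≤ k + 1 := hc.2.resolve_left hpar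
    have hM : m + (n + 2) + 1 ≤ M := hc.1
    rw [mem_levelLE] at hdl
    exact ⟨by omega, .inr (by omega)⟩

lemma iterate_eqnStep_sModEq {M : ℕ} {p q : Jet} (hp : p ∈ jetDomain η₁ η₂ I J)
    (hq : q ∈ jetDomain η₁ η₂ I J) (h : p ≡ q [SMOD (coords (knownLE 0 M)).ker]) (k : ℕ) :
    (eqnStep η₁ η₂)^[k] p ≡ (eqnStep η₁ η₂)^[k] q [SMOD (coords (knownLE k M)).ker] := by
  induction k with
  | zero => exact h
  | succ k ih =>
    simp only [Function.iterate_succ_apply']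
    exact hd.eqnStep_sModEq (iterate_eqnStep_mem hp k) (iterate_eqnStep_mem hq k) ih

lemma iterate_eqnStep_sModEq_of_le {p : Jet} (hp : p ∈ jetDomain η₁ η₂ I J) {k l : ℕ}
    (hkl : k ≤ l) (M : ℕ) :
    (eqnStep η₁ η₂)^[l] p ≡ (eqnStep η₁ η₂)^[k] p [SMOD (coords (knownLE k M)).ker] := by
  obtain ⟨j, rfl⟩ := Nat.exists_eq_add_of_le hkl
  rw [Function.iterate_add_apply]
  exact hd.iterate_eqnStep_sModEq (iterate_eqnStep_mem hp j) hp
    (iterate_eqnStep_sModEq_self j M p) k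

lemma jetNormal_sModEq_iterate {p : Jet} (hp : p ∈ jetDomain η₁ η₂ I J) (M : ℕ) :
    jetNormal η₁ η₂ p ≡ (eqnStep η₁ η₂)^[M] p [SMOD (coords (levelLE M)).ker] := by
  refine sModEq_ker_coords.2 fun c hc => ?_
  rw [jetNormal, coord_ofCoord]
  exact (sModEq_ker_coords.1 (hd.iterate_eqnStep_sModEq_of_le hp hc c.level) c
    ⟨le_rfl, .inr le_rfl⟩).symm

lemma jetNormal_sModEq {M : ℕ} {p q : Jet} (hp : p ∈ jetDomain η₁ η₂ I J)
    (hq : q ∈ jetDomain η₁ η₂ I J) (h : p ≡ q [SMOD (coords (knownLE 0 M)).ker]) :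
    jetNormal η₁ η₂ p ≡ jetNormal η₁ η₂ q [SMOD (coords (levelLE M)).ker] :=
  (hd.jetNormal_sModEq_iterate hp M).trans <|
    (knownLE_self M ▸ hd.iterate_eqnStep_sModEq hp hq h M).trans
      (hd.jetNormal_sModEq_iterate hq M).symm

lemma eqnStep_jetNormal {p : Jet} (hp : p ∈ jetDomain η₁ η₂ I J) :
    eqnStep η₁ η₂ (jetNormal η₁ η₂ p) = jetNormal η₁ η₂ p := by
  refine jet_ext fun c => ?_
  have hiter := hd.jetNormal_sModEq_iterate hp c.level
  rw [← knownLE_self] at hiter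
  have hstep := (hd.eqnStep_sModEq (jetNormal_mem_jetDomain hp)
    (iterate_eqnStep_mem hp c.level) hiter).mono
      (ker_coords_anti (knownLE_mono c.level.le_succ c.level))
  rw [← Function.iterate_succ_apply' (eqnStep η₁ η₂)] at hstep
  exact sModEq_ker_coords.1 ((hstep.trans
    (hd.iterate_eqnStep_sModEq_of_le hp c.level.le_succ c.level)).trans hiter.symm) c
      ⟨le_rfl, .inr le_rfl⟩

lemma jetNormal_mem {p : Jet} (hp : p ∈ jetDomain η₁ η₂ I J) :
    jetNormal η₁ η₂ p ∈ equationManifold η₁ η₂ I J :=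
  hd.mem_equationManifold_iff.2 ⟨jetNormal_mem_jetDomain hp, hd.eqnStep_jetNormal hp⟩

lemma jetNormal_eq_self {p : Jet} (hp : p ∈ equationManifold η₁ η₂ I J) :
    jetNormal η₁ η₂ p = p := by
  refine jet_ext fun c => ?_
  rw [jetNormal, coord_ofCoord, Function.iterate_fixed (hd.mem_equationManifold_iff.1 hp).2]

lemma plotSmoothOn_eqnStep : PlotSmoothOn (jetDomain η₁ η₂ I J) (eqnStep η₁ η₂) := by
  refine fun E _ _ γ e hγ he => isPlotAt_jet fun c => ?_
  rcases c with a | ⟨a, m, _ | _ | n⟩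
  · simpa only [eqnStep, coord_ofCoord] using hγ (coord (base a))
  · simpa only [eqnStep, coord_ofCoord] using hγ (coord (fibre a m 0))
  · simpa only [eqnStep, coord_ofCoord] using hγ (coord (fibre a m 1))
  · simpa only [coord_eqnStep_fibre] using
      (hd.plotSmoothOn_prolong a m n).contDiffAt_comp hγ he

lemma plotSmoothOn_jetNormal : PlotSmoothOn (jetDomain η₁ η₂ I J) (jetNormal η₁ η₂) := by
  have hiter (k : ℕ) : PlotSmoothOn (jetDomain η₁ η₂ I J) (eqnStep η₁ η₂)^[k] := by
    induction k with
    | zero => exact fun _ _ _ _ _ hγ _ => hγ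
    | succ k ih =>
      intro E _ _ γ e hγ he
      simpa only [Function.iterate_succ_apply'] using
        hd.plotSmoothOn_eqnStep (ih hγ he) (iterate_eqnStep_mem he k)
  intro E _ _ γ e hγ he
  refine isPlotAt_jet fun c => ?_
  simpa only [jetNormal, coord_ofCoord] using hiter c.level hγ he (coord c)

lemma total_prolong {p : Jet} (hp : p ∈ equationManifold η₁ η₂ I J) (a b : Axis) (m n : ℕ) :
    total a (prolong η₁ η₂ b m n) p = coord (fibre b m (n + 2)) (totalField a p) := by
  obtain ⟨hdom, hfix⟩ := hd.mem_equationManifold_iff.1 hp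
  rw [eqnStep_eq_self_iff] at hfix
  obtain rfl | rfl := b.eq_or_eq_other a
  · rw [coord_fibre_totalField, hfix]
    exact total_totalIter hd.plotOpen_jetDomain (hd.plotSmoothOn_rhs a) a m n hdom
  · rw [coord_fibre_totalField_other, hfix b m (n + 1)]
    exact total_other_totalIter hd.plotOpen_jetDomain (hd.plotSmoothOn_rhs b) b m n hdom

/-- The total derivative fields are tangent to the equation. -/
lemma hasDerivAt_coord_jetNormal {p : Jet} (hp : p ∈ equationManifold η₁ η₂ I J) (a : Axis)
    (c : JetCoord) : HasDerivAt (fun t : ℝ => coord c (jetNormal η₁ η₂ (p + t • totalField a p)))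
      (coord c (totalField a p)) 0 := by
  have hline := isPlotAt_line p (totalField a p) 0
  have h0 : p + (0 : ℝ) • totalField a p ∈ jetDomain η₁ η₂ I J := by simpa using hp.1
  induction hc : c.level using Nat.strong_induction_on generalizing c with
  | _ N ih =>
  by_cases hpar : c.IsParametric
  · simp only [sModEq_ker_coords.1 (jetNormal_sModEq_self c.level _) c ⟨le_rfl, .inl hpar⟩,
      map_add, map_smul, smul_eq_mul]
    simpa using ((hasDerivAt_id (0 : ℝ)).mul_const (coord c (totalField a p))).const_add (coord c p)
  rcases c with b | ⟨b, m, _ | _ | n⟩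
  · exact absurd trivial hpar
  · exact absurd Nat.zero_lt_two hpar
  · exact absurd Nat.one_lt_two hpar
  · have hchain := (hd.plotSmoothOn_prolong b m n).hasDerivAt_comp_of_coord hd.plotOpen_jetDomain
      (finite_levelLE _) (hd.invariantOn_prolong b m n) (hd.plotSmoothOn_jetNormal hline h0)
      (jetNormal_mem_jetDomain h0) (v := totalField a p) fun d hdl => ih d.level (by
        rw [mem_levelLE] at hdl
        simp only [level] at hc
        omega) d rfl
    rw [zero_smul, add_zero, hd.jetNormal_eq_self hp, ← total_apply, hd.total_prolong hp] at hchain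
    refine hchain.congr_of_eventuallyEq ?_
    filter_upwards [hd.plotOpen_jetDomain hline h0] with t ht
    exact eqnStep_eq_self_iff.1 (hd.eqnStep_jetNormal ht) b m n

end SmoothData

end NormalForm

open PowerSeries

section BinomialSeries

lemma powSeries_eq_expand (r c : ℝ) :
    powSeries r c = expand 2 two_ne_zero (rescale (c : ℂ) (binomialSeries ℂ r)) := by
  ext m
  rw [powSeries, coeff_mk]
  split_ifs with hm
  · obtain ⟨k, rfl⟩ := hm.two_dvd
    have hdesc : ∏ i ∈ Finset.range k, (r - i) = (descPochhammer ℤ k).smeval r := by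
      rw [← descPochhammer_eval_eq_prod_range, ← Polynomial.aeval_eq_smeval, Polynomial.aeval_def,
        Polynomial.eval₂_eq_eval_map, descPochhammer_map]
    rw [coeff_expand_mul, coeff_rescale, binomialSeries_coeff, Ring.choose_eq_smul,
      Nat.mul_div_cancel_left k two_pos, hdesc]
    simp only [smul_eq_mul, Complex.real_smul, mul_one]
    push_cast
    ring
  · rw [coeff_expand_of_not_dvd _ _ _ (mt even_iff_two_dvd.2 hm)]

lemma powSeries_mul (r s c : ℝ) : powSeries r c * powSeries s c = powSeries (r + s) c := by
  simp only [powSeries_eq_expand, binomialSeries_add, map_mul]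

lemma powSeries_zero (c : ℝ) : powSeries 0 c = 1 := by
  rw [powSeries_eq_expand, binomialSeries_zero, map_one, map_one]

lemma powSeries_one (c : ℝ) : powSeries 1 c = 1 + C (c : ℂ) * X ^ 2 := by
  have h := binomialSeries_nat (R := ℝ) (A := ℂ) 1
  rw [Nat.cast_one, pow_one] at h
  rw [powSeries_eq_expand, h, map_add, map_add, map_one, map_one, rescale_X, map_mul, expand_C,
    expand_X]

lemma constantCoeff_powSeries (r c : ℝ) : constantCoeff (powSeries r c) = 1 := by
  rw [← coeff_zero_eq_constantCoeff_apply, powSeries, coeff_mk]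
  simp

end BinomialSeries

section SeriesCalculus

/-- Coefficientwise derivative of a curve of power series. -/
def HasSeriesDeriv (P : ℝ → ℂ⟦X⟧) (dP : ℂ⟦X⟧) (t : ℝ) : Prop :=
  ∀ k, HasDerivAt (fun s => coeff k (P s)) (coeff k dP) t

/-- Coefficientwise smoothness of a family of power series. -/
def SeriesSmoothAt {E : Type} [NormedAddCommGroup E] [NormedSpace ℝ E] (P : E → ℂ⟦X⟧) (e : E) :
    Prop :=
  ∀ k, ContDiffAt ℝ ∞ (fun z => coeff k (P z)) e

variable {P Q : ℝ → ℂ⟦X⟧} {P' Q' : ℂ⟦X⟧} {t : ℝ}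

lemma hasSeriesDeriv_const (R : ℂ⟦X⟧) : HasSeriesDeriv (fun _ => R) 0 t := fun k => by
  simpa using hasDerivAt_const t (coeff k R)

lemma HasSeriesDeriv.add (hP : HasSeriesDeriv P P' t) (hQ : HasSeriesDeriv Q Q' t) :
    HasSeriesDeriv (fun s => P s + Q s) (P' + Q') t := fun k => by
  simpa using (hP k).fun_add (hQ k)

lemma HasSeriesDeriv.sub (hP : HasSeriesDeriv P P' t) (hQ : HasSeriesDeriv Q Q' t) :
    HasSeriesDeriv (fun s => P s - Q s) (P' - Q') t := fun k => by
  simpa using (hP k).fun_sub (hQ k)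

lemma HasSeriesDeriv.mul (hP : HasSeriesDeriv P P' t) (hQ : HasSeriesDeriv Q Q' t) :
    HasSeriesDeriv (fun s => P s * Q s) (P' * Q t + P t * Q') t := fun k => by
  simp only [map_add, coeff_mul, ← Finset.sum_add_distrib]
  exact HasDerivAt.fun_sum fun x _ => (hP x.1).fun_mul (hQ x.2)

lemma hasSeriesDeriv_C {f : ℝ → ℂ} {f' : ℂ} (hf : HasDerivAt f f' t) :
    HasSeriesDeriv (fun s => C (f s)) (C f') t := fun k => by
  simp only [coeff_C]
  split_ifs
  · exact hf
  · exact hasDerivAt_const _ _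

lemma hasSeriesDeriv_powSeries {f : ℝ → ℝ} {f' : ℝ} (hf : HasDerivAt f f' t) (r : ℝ) :
    HasSeriesDeriv (fun s => powSeries r (f s))
      (C ((r * f' : ℝ) : ℂ) * X ^ 2 * powSeries (r - 1) (f t)) t := by
  intro m
  rw [mul_assoc, coeff_C_mul, coeff_X_pow_mul']
  simp only [powSeries, coeff_mk]
  obtain hm | ⟨k, rfl⟩ | ⟨k, rfl⟩ : m < 2 ∨ (∃ k, m = 2 * (k + 1)) ∨ ∃ k, m = 2 * k + 3 := by
    by_cases h : m < 2
    · exact .inl h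
    · rcases Nat.even_or_odd' m with ⟨k, hk | hk⟩
      · exact .inr (.inl ⟨k - 1, by omega⟩)
      · exact .inr (.inr ⟨k - 1, by omega⟩)
  · rw [if_neg (by omega), mul_zero, Nat.div_eq_of_lt hm]
    simpa using hasDerivAt_const t _
  · rw [if_pos (by omega), show 2 * (k + 1) - 2 = 2 * k by omega,
      Nat.mul_div_cancel_left _ two_pos, Nat.mul_div_cancel_left _ two_pos,
      if_pos (even_two_mul k), ← Complex.ofReal_mul]
    simp only [even_two_mul, if_true]
    refine ((hf.fun_pow (k + 1)).const_mul _).ofReal_comp.congr_deriv ?_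
    rw [Finset.prod_range_succ', Nat.factorial_succ]
    simp only [Nat.cast_succ, Nat.cast_zero, sub_zero, Nat.cast_mul, sub_add_eq_sub_sub_swap,
      Nat.add_sub_cancel]
    field_simp
  · have hodd : ¬ Even (2 * k + 3) := by simp [parity_simps]
    have hodd_pred : ¬ Even (2 * k + 3 - 2) := by
      rw [show 2 * k + 3 - 2 = 2 * k + 1 by omega]; simp [parity_simps]
    simpa [hodd, hodd_pred] using hasDerivAt_const t (0 : ℂ)

section Smooth

variable {E : Type} [NormedAddCommGroup E] [NormedSpace ℝ E] {P Q : E → ℂ⟦X⟧} {e : E}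

lemma seriesSmoothAt_const (R : ℂ⟦X⟧) : SeriesSmoothAt (fun _ : E => R) e :=
  fun _ => contDiffAt_const

lemma SeriesSmoothAt.add (hP : SeriesSmoothAt P e) (hQ : SeriesSmoothAt Q e) :
    SeriesSmoothAt (fun z => P z + Q z) e := fun k => by
  simpa using (hP k).add (hQ k)

lemma SeriesSmoothAt.sub (hP : SeriesSmoothAt P e) (hQ : SeriesSmoothAt Q e) :
    SeriesSmoothAt (fun z => P z - Q z) e := fun k => by
  simpa using (hP k).sub (hQ k)

lemma SeriesSmoothAt.mul (hP : SeriesSmoothAt P e) (hQ : SeriesSmoothAt Q e) :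
    SeriesSmoothAt (fun z => P z * Q z) e := fun k => by
  simp only [coeff_mul]
  exact ContDiffAt.sum fun x _ => (hP x.1).mul (hQ x.2)

lemma seriesSmoothAt_C {f : E → ℂ} (hf : ContDiffAt ℝ ∞ f e) :
    SeriesSmoothAt (fun z => C (f z)) e := fun k => by
  simp only [coeff_C]
  split_ifs
  · exact hf
  · exact contDiffAt_const

lemma seriesSmoothAt_powSeries {f : E → ℝ} (hf : ContDiffAt ℝ ∞ f e) (r : ℝ) :
    SeriesSmoothAt (fun z => powSeries r (f z)) e := fun k => by
  simp only [powSeries, coeff_mk]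
  split_ifs
  · exact Complex.ofRealCLM.contDiff.contDiffAt.comp e (contDiffAt_const.mul (hf.pow _))
  · exact contDiffAt_const

end Smooth

end SeriesCalculus

/-- The coefficients `(a, b, c)` of a Riccati equation `W' = a W² + b W + c` over formal power
series. -/
abbrev Riccati : Type := ℂ⟦X⟧ × ℂ⟦X⟧ × ℂ⟦X⟧

/-- The nonlocal variable `θ_k`, extended by zero as in `theta`. -/
def fibreVar {n : ℕ} (k : ℕ) (θ : Fin n → ℂ) : ℂ := if h : k < n then θ ⟨k, h⟩ else 0

/-- The series `1 + θ_1 μ + θ_2 μ² + ⋯`, as in `thetaSeries`. -/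
def fibreSeries {n : ℕ} (θ : Fin n → ℂ) : ℂ⟦X⟧ :=
  PowerSeries.mk fun k => if k = 0 then 1 else fibreVar k θ

/-- The series whose coefficients are the derivatives `θ_k'` when `W = e^{θ_0} (1 + θ_1 μ + ⋯)`
satisfies `W' = a W² + b W + c` with `a`, `c` divisible by `μ`: it is `W' / e^{θ_0}` with the
contribution `θ_0' (θ_1 μ + θ_2 μ² + ⋯)` of the exponential removed, and `θ_0' = b(0)`. -/
def flow {n : ℕ} (R : Riccati) (θ : Fin n → ℂ) : ℂ⟦X⟧ :=
  C (Complex.exp (fibreVar 0 θ)) * R.1 * (fibreSeries θ * fibreSeries θ)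
    + C (Complex.exp (-fibreVar 0 θ)) * R.2.2
    + (R.2.1 - C (constantCoeff R.2.1)) * fibreSeries θ + C (constantCoeff R.2.1)

/-- The vector field which a Riccati equation induces on the space of the first `n` nonlocal
variables. -/
def flowField (n : ℕ) (R : Riccati) (θ : Fin n → ℂ) : Fin n → ℂ := fun k => coeff k (flow R θ)

/-- The commutator of the vector fields `(a W² + b W + c) ∂_W` of two Riccati equations. -/
def riccatiBracket (R S : Riccati) : Riccati :=
  (S.1 * R.2.1 - R.1 * S.2.1, 2 * (S.1 * R.2.2 - R.1 * S.2.2), S.2.1 * R.2.2 - R.2.1 * S.2.2)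

/-- The Riccati equations with `a` and `c` divisible by `μ`; these preserve the form
`e^{θ_0} (1 + θ_1 μ + ⋯)` of the solution. -/
def Riccati.Small (R : Riccati) : Prop := constantCoeff R.1 = 0 ∧ constantCoeff R.2.2 = 0

section Flow

variable {n : ℕ} {R S : Riccati}

lemma Riccati.Small.bracket (hR : R.Small) (hS : S.Small) : (riccatiBracket R S).Small := by
  simp [Riccati.Small, riccatiBracket, hR.1, hR.2, hS.1, hS.2]

lemma constantCoeff_riccatiBracket (hR : R.Small) (hS : S.Small) :
    constantCoeff (riccatiBracket R S).2.1 = 0 := by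
  simp [riccatiBracket, hR.1, hR.2, hS.1, hS.2]

lemma flow_add (R S : Riccati) (θ : Fin n → ℂ) : flow (R + S) θ = flow R θ + flow S θ := by
  simp only [flow, Prod.fst_add, Prod.snd_add, map_add]; ring

lemma flow_smul (r : ℝ) (R : Riccati) (θ : Fin n → ℂ) : flow (r • R) θ = r • flow R θ := by
  have h : ∀ P : ℂ⟦X⟧, r • P = C (r : ℂ) * P := fun P => by
    ext k; simp [coeff_C_mul]
  simp only [flow, Prod.smul_fst, Prod.smul_snd, h, map_mul, constantCoeff_C]; ring

lemma flow_sub (R S : Riccati) (θ : Fin n → ℂ) : flow (R - S) θ = flow R θ - flow S θ := by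
  simp only [flow, Prod.fst_sub, Prod.snd_sub, map_sub]; ring

lemma constantCoeff_flow (hR : R.Small) (θ : Fin n → ℂ) :
    constantCoeff (flow R θ) = constantCoeff R.2.1 := by
  simp [flow, hR.1, hR.2]

/-- The derivative of `fibreSeries` along a vector. -/
def fibreSeriesDeriv (v : Fin n → ℂ) : ℂ⟦X⟧ :=
  PowerSeries.mk fun k => if k = 0 then 0 else fibreVar k v

/-- The derivative of `flow R` at `θ` along a vector `v`. -/
def flowDeriv (R : Riccati) (θ v : Fin n → ℂ) : ℂ⟦X⟧ :=
  C (fibreVar 0 v) * (C (Complex.exp (fibreVar 0 θ)) * R.1 * fibreSeries θ ^ 2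
      - C (Complex.exp (-fibreVar 0 θ)) * R.2.2)
    + (2 * C (Complex.exp (fibreVar 0 θ)) * R.1 * fibreSeries θ
      + (R.2.1 - C (constantCoeff R.2.1))) * fibreSeriesDeriv v

lemma constantCoeff_flowDeriv (hR : R.Small) (θ v : Fin n → ℂ) :
    constantCoeff (flowDeriv R θ v) = 0 := by
  simp [flowDeriv, hR.1, hR.2]

lemma X_pow_dvd_fibreSeriesDeriv_flowField_sub (hR : R.Small) (θ : Fin n → ℂ) :
    X ^ n ∣ fibreSeriesDeriv (flowField n R θ) - (flow R θ - C (constantCoeff R.2.1)) := by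
  refine X_pow_dvd_iff.2 fun m hm => ?_
  rcases m with _ | m
  · simp [fibreSeriesDeriv, constantCoeff_flow hR]
  · simp [fibreSeriesDeriv, fibreVar, hm, flowField]

lemma X_dvd_flow_slope (hR : R.Small) (θ : Fin n → ℂ) :
    X ∣ 2 * C (Complex.exp (fibreVar 0 θ)) * R.1 * fibreSeries θ
      + (R.2.1 - C (constantCoeff R.2.1)) := by
  rw [X_dvd_iff]
  simp [hR.1]

lemma fibreVar_zero_flowField (hn : 0 < n) (hR : R.Small) (θ : Fin n → ℂ) :
    fibreVar 0 (flowField n R θ) = constantCoeff R.2.1 := by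
  simp [fibreVar, hn, flowField, constantCoeff_flow hR]

/-- Both `flowDeriv`s see the fields of `R` and `S` only modulo `X ^ n`, but multiply them by
series divisible by `X`. -/
lemma X_pow_dvd_flowDeriv_sub_flowDeriv_sub (hn : 0 < n) (hR : R.Small) (hS : S.Small)
    (θ : Fin n → ℂ) :
    X ^ (n + 1) ∣ flowDeriv S θ (flowField n R θ) - flowDeriv R θ (flowField n S θ)
      - flow (riccatiBracket R S) θ := by
  have dvd_left := mul_dvd_mul (X_dvd_flow_slope hS θ)
    (X_pow_dvd_fibreSeriesDeriv_flowField_sub hR θ)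
  have dvd_right := mul_dvd_mul (X_dvd_flow_slope hR θ)
    (X_pow_dvd_fibreSeriesDeriv_flowField_sub hS θ)
  rw [← pow_succ'] at dvd_left dvd_right
  have exp_mul_exp_neg :
      (C (Complex.exp (fibreVar 0 θ)) * C (Complex.exp (-fibreVar 0 θ)) : ℂ⟦X⟧) = 1 := by
    rw [← map_mul, ← Complex.exp_add, add_neg_cancel, Complex.exp_zero, map_one]
  convert dvd_sub dvd_left dvd_right using 1
  rw [flowDeriv, flowDeriv, fibreVar_zero_flowField hn hR, fibreVar_zero_flowField hn hS,
    flow.eq_1 (riccatiBracket R S), constantCoeff_riccatiBracket hR hS, map_zero]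
  simp only [flow, riccatiBracket]
  linear_combination (2 * fibreSeries θ * (S.1 * R.2.2 - R.1 * S.2.2)) * exp_mul_exp_neg

lemma coeff_flowDeriv_sub (hR : R.Small) (hS : S.Small) (θ : Fin n → ℂ) {k : ℕ} (hk : k ≤ n) :
    coeff k (flowDeriv S θ (flowField n R θ)) - coeff k (flowDeriv R θ (flowField n S θ))
      = coeff k (flow (riccatiBracket R S) θ) := by
  rcases Nat.eq_zero_or_pos n with rfl | hn
  · obtain rfl : k = 0 := by omega
    simp [constantCoeff_flowDeriv hR, constantCoeff_flowDeriv hS,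
      constantCoeff_flow (hR.bracket hS), constantCoeff_riccatiBracket hR hS]
  · rw [← sub_eq_zero, ← map_sub, ← map_sub]
    exact X_pow_dvd_iff.1 (X_pow_dvd_flowDeriv_sub_flowDeriv_sub hn hR hS θ) k (by omega)

end Flow

section Deriv

variable {n : ℕ} {θ : ℝ → Fin n → ℂ} {v : Fin n → ℂ} {t : ℝ}

lemma hasDerivAt_fibreVar (h : HasDerivAt θ v t) (k : ℕ) :
    HasDerivAt (fun s => fibreVar k (θ s)) (fibreVar k v) t := by
  unfold fibreVar
  split_ifs with hk
  · exact hasDerivAt_pi.1 h _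
  · exact hasDerivAt_const _ _

lemma hasSeriesDeriv_fibreSeries (h : HasDerivAt θ v t) :
    HasSeriesDeriv (fun s => fibreSeries (θ s)) (fibreSeriesDeriv v) t := fun k => by
  simp only [fibreSeries, fibreSeriesDeriv, coeff_mk]
  split_ifs
  · exact hasDerivAt_const _ _
  · exact hasDerivAt_fibreVar h k

/-- Coefficientwise derivative of a curve of Riccati equations. -/
def HasRiccatiDeriv (R : ℝ → Riccati) (R' : Riccati) (t : ℝ) : Prop :=
  HasSeriesDeriv (fun s => (R s).1) R'.1 t ∧ HasSeriesDeriv (fun s => (R s).2.1) R'.2.1 t ∧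
    HasSeriesDeriv (fun s => (R s).2.2) R'.2.2 t

lemma hasRiccatiDeriv_const (R : Riccati) : HasRiccatiDeriv (fun _ => R) 0 t :=
  ⟨hasSeriesDeriv_const _, hasSeriesDeriv_const _, hasSeriesDeriv_const _⟩

lemma HasRiccatiDeriv.flow {R : ℝ → Riccati} {R' : Riccati} (hR : HasRiccatiDeriv R R' t)
    (hθ : HasDerivAt θ v t) :
    HasSeriesDeriv (fun s => flow (R s) (θ s))
      (SDeform.flow R' (θ t) + flowDeriv (R t) (θ t) v) t := by
  obtain ⟨ha, hb, hc⟩ := hR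
  have hθ₀ := hasDerivAt_fibreVar hθ 0
  have hT := hasSeriesDeriv_fibreSeries hθ
  have hb₀ : HasDerivAt (fun s => constantCoeff (R s).2.1) (constantCoeff R'.2.1) t := by
    simpa using hb 0
  have key := ((((hasSeriesDeriv_C hθ₀.cexp).mul ha).mul (hT.mul hT)).add
    ((hasSeriesDeriv_C hθ₀.fun_neg.cexp).mul hc)).add
    ((hb.sub (hasSeriesDeriv_C hb₀)).mul hT) |>.add (hasSeriesDeriv_C hb₀)
  refine Eq.subst (motive := fun P => HasSeriesDeriv (fun s => SDeform.flow (R s) (θ s)) P t) ?_ key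
  simp only [SDeform.flow, flowDeriv, map_mul, map_neg]
  ring

end Deriv

section Smooth

variable {E : Type} [NormedAddCommGroup E] [NormedSpace ℝ E] {n : ℕ} {θ : E → Fin n → ℂ} {e : E}

lemma contDiffAt_fibreVar (h : ContDiffAt ℝ ∞ θ e) (k : ℕ) :
    ContDiffAt ℝ ∞ (fun z => fibreVar k (θ z)) e := by
  unfold fibreVar
  split_ifs with hk
  · exact contDiffAt_pi.1 h _
  · exact contDiffAt_const

lemma seriesSmoothAt_fibreSeries (h : ContDiffAt ℝ ∞ θ e) :
    SeriesSmoothAt (fun z => fibreSeries (θ z)) e := fun k => by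
  simp only [fibreSeries, coeff_mk]
  split_ifs
  · exact contDiffAt_const
  · exact contDiffAt_fibreVar h k

lemma seriesSmoothAt_flow {R : E → Riccati} (ha : SeriesSmoothAt (fun z => (R z).1) e)
    (hb : SeriesSmoothAt (fun z => (R z).2.1) e) (hc : SeriesSmoothAt (fun z => (R z).2.2) e)
    (h : ContDiffAt ℝ ∞ θ e) : SeriesSmoothAt (fun z => flow (R z) (θ z)) e := by
  have hθ₀ := contDiffAt_fibreVar h 0
  have hT := seriesSmoothAt_fibreSeries h
  have hb₀ : ContDiffAt ℝ ∞ (fun z => constantCoeff (R z).2.1) e := by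
    simpa using hb 0
  exact ((((seriesSmoothAt_C hθ₀.cexp).mul ha).mul (hT.mul hT)).add
    ((seriesSmoothAt_C hθ₀.neg.cexp).mul hc)).add
    ((hb.sub (seriesSmoothAt_C hb₀)).mul hT) |>.add (seriesSmoothAt_C hb₀)

lemma contDiff_coeff_flow (R : Riccati) (k : ℕ) :
    ContDiff ℝ ∞ fun θ : Fin n → ℂ => coeff k (flow R θ) :=
  contDiff_iff_contDiffAt.2 fun _ => seriesSmoothAt_flow (seriesSmoothAt_const _)
    (seriesSmoothAt_const _) (seriesSmoothAt_const _) contDiffAt_id k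

lemma contDiff_flowField (n : ℕ) (R : Riccati) : ContDiff ℝ ∞ (flowField n R) :=
  contDiff_pi.2 fun k => contDiff_coeff_flow R k

lemma fderiv_coeff_flow (R : Riccati) (k : ℕ) (θ v : Fin n → ℂ) :
    fderiv ℝ (fun θ : Fin n → ℂ => coeff k (flow R θ)) θ v = coeff k (flowDeriv R θ v) := by
  have hline : HasDerivAt (fun t : ℝ => θ + t • v) v 0 := by
    simpa using ((hasDerivAt_id (0 : ℝ)).smul_const v).const_add θ
  have hchain := HasFDerivAt.comp_hasDerivAt_of_eq (0 : ℝ)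
    ((contDiff_coeff_flow R k).differentiable (by simp) θ).hasFDerivAt hline (by simp)
  rw [hchain.unique ((hasRiccatiDeriv_const R).flow hline k)]
  simp [flow]

lemma fderiv_flowField_apply (R : Riccati) (θ v : Fin n → ℂ) (k : Fin n) :
    fderiv ℝ (flowField n R) θ v k = coeff k (flowDeriv R θ v) := by
  have hdiff := (contDiff_flowField n R).differentiable (by simp) θ
  rw [← fderiv_coeff_flow]
  exact (DFunLike.congr_fun (hasFDerivAt_pi'.1 hdiff.hasFDerivAt k).fderiv v).symm

lemma lieBracket_flowField {R S : Riccati} (hR : R.Small) (hS : S.Small) (θ : Fin n → ℂ) :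
    VectorField.lieBracket ℝ (flowField n R) (flowField n S) θ
      = flowField n (riccatiBracket R S) θ := by
  funext k
  rw [VectorField.lieBracket, Pi.sub_apply, fderiv_flowField_apply, fderiv_flowField_apply,
    coeff_flowDeriv_sub hR hS θ k.2.le]
  rfl

end Smooth

/-- The Riccati equations whose field on the variables `θ_0, …, θ_n` is tangent to the graph
`θ_n = g(θ_0, …, θ_{n-1})`. -/
def Lifts {n : ℕ} (g : (Fin n → ℂ) → ℂ) (R : Riccati) : Prop :=
  R.Small ∧ ∀ θ, fderiv ℝ g θ (flowField n R θ) = coeff n (flow R θ)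

namespace Lifts

variable {n : ℕ} {g : (Fin n → ℂ) → ℂ} {R S : Riccati}

lemma add (hR : Lifts g R) (hS : Lifts g S) : Lifts g (R + S) := by
  refine ⟨⟨by simp [hR.1.1, hS.1.1], by simp [hR.1.2, hS.1.2]⟩, fun θ => ?_⟩
  have hfield : flowField n (R + S) θ = flowField n R θ + flowField n S θ := by
    funext k; simp [flowField, flow_add]
  rw [hfield, map_add, hR.2, hS.2, flow_add, map_add]

lemma smul (r : ℝ) (hR : Lifts g R) : Lifts g (r • R) := by
  refine ⟨⟨?_, ?_⟩, fun θ => ?_⟩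
  · rw [Prod.smul_fst, ← coeff_zero_eq_constantCoeff_apply, coeff_smul]; simp [hR.1.1]
  · rw [Prod.smul_snd, Prod.smul_snd, ← coeff_zero_eq_constantCoeff_apply, coeff_smul]
    simp [hR.1.2]
  have hfield : flowField n (r • R) θ = r • flowField n R θ := by
    funext k; simp [flowField, flow_smul]
  rw [hfield, map_smul, hR.2, flow_smul, coeff_smul]

lemma bracket (hg : ContDiff ℝ ∞ g) (hR : Lifts g R) (hS : Lifts g S) :
    Lifts g (riccatiBracket R S) := by
  refine ⟨hR.1.bracket hS.1, fun θ => ?_⟩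
  have hdiff (Q : Riccati) : DifferentiableAt ℝ (flowField n Q) θ :=
    (contDiff_flowField n Q).differentiable (by simp) θ
  rw [← lieBracket_flowField hR.1 hS.1, VectorField.fderiv_apply_lieBracket (n := ∞) hg.contDiffAt
    (by rw [minSmoothness_of_isRCLikeNormedField]
        exact WithTop.coe_le_coe.2 (le_top : (2 : ℕ∞) ≤ ⊤)) (hdiff S) (hdiff R)]
  simp only [hR.2, hS.2, fderiv_coeff_flow]
  exact coeff_flowDeriv_sub hR.1 hS.1 θ le_rfl

lemma coeff_flow_eq_zero (hR : Lifts g R) (θ : Fin n → ℂ)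
    (h : ∀ k < n, coeff k (flow R θ) = 0) : coeff n (flow R θ) = 0 := by
  have hfield : flowField n R θ = 0 := funext fun k => h k k.2
  rw [← hR.2 θ, hfield, map_zero]

/-- A Riccati equation which starts at the order `n` exactly moves `θ_n` without moving
`θ_0, …, θ_{n-1}`, so it does not lift. -/
lemma constantCoeff_eq_zero (hR : Lifts g R) {P : ℂ⟦X⟧} (h : R.1 + R.2.2 + R.2.1 = X ^ n * P) :
    constantCoeff P = 0 := by
  have flow_zero : flow R (0 : Fin n → ℂ) = X ^ n * P := by
    have hone : fibreSeries (0 : Fin n → ℂ) = 1 := by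
      ext k; simp [fibreSeries, fibreVar, coeff_one]
    have hvar : fibreVar 0 (0 : Fin n → ℂ) = 0 := by simp [fibreVar]
    rw [← h, flow, hone, hvar, neg_zero, Complex.exp_zero, map_one]
    ring
  have hn := hR.coeff_flow_eq_zero 0 fun k hk => by
    rw [flow_zero, coeff_X_pow_mul', if_neg (by omega)]
  rwa [flow_zero, coeff_X_pow_mul', if_pos le_rfl, Nat.sub_self,
    coeff_zero_eq_constantCoeff_apply] at hn

end Lifts

section RiccatiFamily

/-- The common shape of the Riccati equations of the coverings along the two axes, with `c` the
parameter `η_j` of the axis and `d` the parameter of the other axis. -/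
def riccati (c d : ℝ) (a b a' : ℂ) : Riccati :=
  (C a * (C (1 / 2) * X * alphaSeries c), C b * alphaRatioSeries d c,
    C a' * (C (1 / 2) * X * alphaSeries c))

/-- The derivative of `riccati c d a b a'` when `d`, `a`, `b`, `a'` have the derivatives `d₁`,
`a₁`, `b₁`, `a₁'` and `c` is constant. -/
def riccatiDeriv (c d d₁ : ℝ) (b a₁ b₁ a₁' : ℂ) : Riccati :=
  (C a₁ * (C (1 / 2) * X * alphaSeries c),
    C b₁ * alphaRatioSeries d c + C (1 / 2 * b * d₁) * X ^ 2 * alphaSeries d * alphaSeries c,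
    C a₁' * (C (1 / 2) * X * alphaSeries c))

lemma small_riccati (c d : ℝ) (a b a' : ℂ) : (riccati c d a b a').Small := by
  simp [Riccati.Small, riccati]

lemma constantCoeff_alphaRatioSeries (c d : ℝ) : constantCoeff (alphaRatioSeries c d) = 1 := by
  simp [alphaRatioSeries, constantCoeff_powSeries]

lemma hasRiccatiDeriv_riccati (c : ℝ) {d : ℝ → ℝ} {a b a' : ℝ → ℂ} {d₁ : ℝ} {a₁ b₁ a₁' : ℂ}
    {t : ℝ} (hd : HasDerivAt d d₁ t) (ha : HasDerivAt a a₁ t) (hb : HasDerivAt b b₁ t)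
    (ha' : HasDerivAt a' a₁' t) :
    HasRiccatiDeriv (fun s => riccati c (d s) (a s) (b s) (a' s))
      (riccatiDeriv c (d t) d₁ (b t) a₁ b₁ a₁') t := by
  have hα := hasSeriesDeriv_const (t := t) (C (1 / 2) * X * alphaSeries c)
  have hratio := (hasSeriesDeriv_powSeries hd (1 / 2)).mul
    (hasSeriesDeriv_const (powSeries (-1 / 2) c))
  refine ⟨?_, ?_, ?_⟩
  · simpa [riccati, riccatiDeriv] using (hasSeriesDeriv_C ha).mul hα
  · convert (hasSeriesDeriv_C hb).mul hratio using 1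
    · rfl
    rw [show (1 / 2 - 1 : ℝ) = -1 / 2 by norm_num]
    simp only [riccatiDeriv, alphaRatioSeries, alphaSeries, Complex.ofReal_mul, map_mul,
      Complex.ofReal_div, Complex.ofReal_one, Complex.ofReal_ofNat]
    ring
  · simpa [riccati, riccatiDeriv] using (hasSeriesDeriv_C ha').mul hα

lemma powSeries_half_mul_alphaSeries (c : ℝ) : powSeries (1 / 2) c * alphaSeries c = 1 := by
  rw [alphaSeries, powSeries_mul, show (1 / 2 + -1 / 2 : ℝ) = 0 by norm_num, powSeries_zero]

lemma one_add_mul_alphaSeries (c : ℝ) :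
    (1 + C (c : ℂ) * X ^ 2) * alphaSeries c = powSeries (1 / 2) c := by
  rw [← powSeries_one, alphaSeries, powSeries_mul]
  norm_num

lemma C_I_mul_C_I : (C Complex.I * C Complex.I : ℂ⟦X⟧) = -1 := by
  rw [← map_mul, Complex.I_mul_I, map_neg, map_one]

lemma two_mul_C_half : (2 * C (1 / 2) : ℂ⟦X⟧) = 1 := by
  rw [two_mul, ← map_add, add_halves, map_one]

/-- The zero curvature representation: `h` is all that remains of the system when the equations
of the covering along the two axes are required to commute. -/
lemma riccatiDeriv_sub_riccatiDeriv {c d c' d' : ℝ} {u v q r p : ℂ}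
    (h : p * (c - d) = 1 / 2 * q * d' + 1 / 2 * r * c' + u * v) :
    riccatiDeriv c d d' (Complex.I * q) (v * q) (Complex.I * p) (v * q)
        - riccatiDeriv d c c' (-(Complex.I * r)) (-(Complex.I * (u * r))) (Complex.I * p)
          (Complex.I * (u * r))
      = riccatiBracket (riccati c d u (Complex.I * q) u)
        (riccati d c (-(Complex.I * v)) (-(Complex.I * r)) (Complex.I * v)) := by
  have hC := congrArg (C (R := ℂ)) h
  simp only [map_mul, map_add, map_sub] at hC
  have hc := powSeries_half_mul_alphaSeries c
  have hd := powSeries_half_mul_alphaSeries d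
  have hc₁ := one_add_mul_alphaSeries c
  have hd₁ := one_add_mul_alphaSeries d
  have hI := C_I_mul_C_I
  have hh := two_mul_C_half
  refine Prod.ext ?_ (Prod.ext ?_ ?_) <;>
    simp only [riccatiDeriv, riccati, riccatiBracket, alphaRatioSeries, ← alphaSeries.eq_1,
      Prod.fst_sub, Prod.snd_sub, map_mul, map_neg]
  · linear_combination
      C v * C q * C (1 / 2) * X * alphaSeries c
          * (powSeries (1 / 2) d * alphaSeries d * hI - hd)
        - C Complex.I * C u * C r * C (1 / 2) * X * alphaSeries d * hc
  · linear_combination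
      C Complex.I * C p * (alphaSeries d * hc₁ - alphaSeries c * hd₁)
        - C Complex.I * X ^ 2 * alphaSeries c * alphaSeries d
          * (hC - C u * C v * (2 * C (1 / 2) + 1) * hh)
  · linear_combination
      C v * C q * C (1 / 2) * X * alphaSeries c
          * (powSeries (1 / 2) d * alphaSeries d * hI - hd)
        + C Complex.I * C u * C r * C (1 / 2) * X * alphaSeries d * hc

end RiccatiFamily

section NoLift

variable {n : ℕ} {g : (Fin n → ℂ) → ℂ} {c d : ℝ}

lemma alphaRatioSeries_sq_sub_one (c d : ℝ) :
    alphaRatioSeries d c ^ 2 - 1 = C ((d : ℂ) - c) * X ^ 2 * alphaSeries c ^ 2 := by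
  have hc := powSeries_half_mul_alphaSeries c
  have hd := powSeries_half_mul_alphaSeries d
  have hc₁ := one_add_mul_alphaSeries c
  have hd₁ := one_add_mul_alphaSeries d
  rw [alphaRatioSeries, ← alphaSeries.eq_1, map_sub]
  linear_combination alphaSeries c ^ 2 * ((1 + C (d : ℂ) * X ^ 2) * hd
    - powSeries (1 / 2) d * hd₁) + hc + alphaSeries c * hc₁

/-- Bracketing twice with `h₁` multiplies an equation without linear term by `-ρ²`, where
`ρ = alphaRatioSeries d c`. -/
lemma lifts_ratio_sq_sub_one_pow (hg : ContDiff ℝ ∞ g)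
    (h₁ : Lifts g (0, C Complex.I * alphaRatioSeries d c, 0)) {Q : ℂ⟦X⟧}
    (h₂ : Lifts g (Q, 0, Q)) (m : ℕ) :
    Lifts g (Q * (alphaRatioSeries d c ^ 2 - 1) ^ m, 0,
      Q * (alphaRatioSeries d c ^ 2 - 1) ^ m) := by
  induction m with
  | zero => simpa using h₂
  | succ m ih =>
    convert ((h₁.bracket hg (h₁.bracket hg ih)).add ih).smul (-1) using 1
    refine Prod.ext ?_ (Prod.ext ?_ ?_)
    · simp only [riccatiBracket, neg_smul, one_smul, Prod.fst_neg, Prod.fst_add]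
      linear_combination (Q * (alphaRatioSeries d c ^ 2 - 1) ^ m * alphaRatioSeries d c ^ 2)
        * C_I_mul_C_I
    · simp [riccatiBracket]
    · simp only [riccatiBracket, neg_smul, one_smul, Prod.snd_neg, Prod.snd_add]
      linear_combination (Q * (alphaRatioSeries d c ^ 2 - 1) ^ m * alphaRatioSeries d c ^ 2)
        * C_I_mul_C_I

lemma not_lifts (hg : ContDiff ℝ ∞ g) (hcd : c ≠ d)
    (h₁ : Lifts g (0, C Complex.I * alphaRatioSeries d c, 0))
    (h₂ : Lifts g (C (1 / 2) * X * alphaSeries c, 0, C (1 / 2) * X * alphaSeries c)) : False := by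
  have hsq := alphaRatioSeries_sq_sub_one c d
  have hα : constantCoeff (alphaSeries c) = 1 := constantCoeff_powSeries _ _
  have hρ := constantCoeff_alphaRatioSeries d c
  have hdc : (d : ℂ) - c ≠ 0 := sub_ne_zero.2 (Complex.ofReal_injective.ne hcd.symm)
  have hodd := lifts_ratio_sq_sub_one_pow hg h₁ h₂
  rw [hsq] at hodd
  set α := alphaSeries c
  set ρ := alphaRatioSeries d c
  rcases Nat.even_or_odd' n with ⟨m, rfl | rfl⟩
  · rcases m with _ | m
    · have h := h₁.constantCoeff_eq_zero (P := C Complex.I * ρ) (by simp)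
      simp [hρ] at h
    · have h := ((hodd 0).bracket hg (h₁.bracket hg (hodd m))).constantCoeff_eq_zero
        (P := C Complex.I * ρ * C ((d : ℂ) - c) ^ m * α ^ (2 * m + 2)) (by
          simp only [riccatiBracket]
          linear_combination (C Complex.I * ρ * X ^ 2 * α ^ 2
            * (C ((d : ℂ) - c) * X ^ 2 * α ^ 2) ^ m * (2 * C (1 / 2) + 1)) * two_mul_C_half)
      simp [hρ, hα, hdc] at h
  · have h := (hodd m).constantCoeff_eq_zero
      (P := C ((d : ℂ) - c) ^ m * α ^ (2 * m + 1)) (by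
        linear_combination (X * α * (C ((d : ℂ) - c) * X ^ 2 * α ^ 2) ^ m) * two_mul_C_half)
    simp [hα, hdc] at h

end NoLift

section Connection

variable (η₁ η₂ : ℝ → ℝ)

/-- The functions `η₁` of `x` and `η₂` of `y`. -/
def param : Axis → ℝ → ℝ
  | .x => η₁
  | .y => η₂

/-- The value of `η₁(x)` or `η₂(y)` at a jet. -/
def eta (a : Axis) (p : Jet) : ℝ := param η₁ η₂ a (coord (base a) p)

/-- The value of `η₁'(x)` or `η₂'(y)` at a jet. -/
def etaDeriv (a : Axis) (p : Jet) : ℝ := deriv (param η₁ η₂ a) (coord (base a) p)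

/-- The quotients `u_y / v` and `v_x / u`, through which the first derivatives enter `ω_s`. -/
def slope (a : Axis) (p : Jet) : ℝ := coord (fibre a 0 1) p / coord (fibre a.other 0 0) p

/-- The total derivative of `slope a` along the other axis. -/
def slopeDeriv (a : Axis) (p : Jet) : ℝ :=
  (coord (fibre a 0 2) p * coord (fibre a.other 0 0) p
    - coord (fibre a 0 1) p * coord (fibre a.other 1 0) p) / coord (fibre a.other 0 0) p ^ 2

/-- The constant factors in the Riccati equations along the two axes. -/
def phase : Axis → ℂ × ℂ × ℂ
  | .x => (1, Complex.I, 1)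
  | .y => (-Complex.I, -Complex.I, Complex.I)

/-- The Riccati equation for `w = e^{θ_0} (1 + θ_1 μ + ⋯)` along an axis, which is equivalent to
the covering along this axis. -/
def connection (a : Axis) (p : Jet) : Riccati :=
  riccati (eta η₁ η₂ a p) (eta η₁ η₂ a.other p) ((phase a).1 * coord (fibre a 0 0) p)
    ((phase a).2.1 * slope a p) ((phase a).2.2 * coord (fibre a 0 0) p)

/-- The total derivative of `connection a` along the other axis. -/
def connectionDeriv (a : Axis) (p : Jet) : Riccati :=
  riccatiDeriv (eta η₁ η₂ a p) (eta η₁ η₂ a.other p) (etaDeriv η₁ η₂ a.other p)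
    ((phase a).2.1 * slope a p) ((phase a).1 * coord (fibre a 0 1) p)
    ((phase a).2.1 * slopeDeriv a p) ((phase a).2.2 * coord (fibre a 0 1) p)

/-- The coefficients of `ω_s` along the two axes. -/
def omegaCoeff (a : Axis) (s : ℕ) {n : ℕ} (p : Cov n) : ℂ :=
  coeff s (flow (connection η₁ η₂ a p.1) p.2)

/-- The total derivative fields on the coverings. -/
def covField (a : Axis) {n : ℕ} (p : Cov n) : Cov n :=
  (totalField a p.1, flowField n (connection η₁ η₂ a p.1) p.2)

variable {η₁ η₂}

lemma coeff_flow_riccati (c d : ℝ) (a b a' : ℂ) {n : ℕ} (θ : Fin n → ℂ) (s : ℕ) :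
    coeff s (flow (riccati c d a b a') θ)
      = b * (if s = 0 then 1 else coeff s ((alphaRatioSeries d c - 1) * fibreSeries θ))
        + coeff s (C (1 / 2) * X * alphaSeries c *
          (C (a * Complex.exp (fibreVar 0 θ)) * fibreSeries θ ^ 2
            + C (a' * Complex.exp (-fibreVar 0 θ)))) := by
  have hflow : flow (riccati c d a b a') θ
      = C b * ((alphaRatioSeries d c - 1) * fibreSeries θ) + C b
        + C (1 / 2) * X * alphaSeries c * (C (a * Complex.exp (fibreVar 0 θ)) * fibreSeries θ ^ 2
            + C (a' * Complex.exp (-fibreVar 0 θ))) := by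
    simp only [flow, riccati, map_mul, constantCoeff_C, constantCoeff_alphaRatioSeries, mul_one]
    ring
  rw [hflow, map_add, map_add, coeff_C_mul]
  rcases eq_or_ne s 0 with rfl | hs
  · simp [constantCoeff_alphaRatioSeries]
  · rw [if_neg hs, coeff_C, if_neg hs, add_zero]

lemma omegaX_eq_omegaCoeff (s : ℕ) {n : ℕ} (p : Cov n) :
    omegaX η₁ η₂ s p = omegaCoeff η₁ η₂ .x s p := by
  rw [omegaCoeff, connection, coeff_flow_riccati, omegaX, X1, ← coeff_C_mul, X21]
  congr 1
  · simp only [phase, slope, Complex.ofReal_div, mul_div_assoc]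
    rfl
  · simp only [phase, one_mul, map_mul]
    change coeff s (C (ju 0 0 p.1 : ℂ) * _) = coeff s (C (1 / 2) * X * alphaSeries (η₁ (jx p.1)) *
      (C (ju 0 0 p.1 : ℂ) * C (Complex.exp (theta 0 p)) * thetaSeries p ^ 2
        + C (ju 0 0 p.1 : ℂ) * C (Complex.exp (-theta 0 p))))
    ring_nf

lemma omegaY_eq_omegaCoeff (s : ℕ) {n : ℕ} (p : Cov n) :
    omegaY η₁ η₂ s p = omegaCoeff η₁ η₂ .y s p := by
  rw [omegaCoeff, connection, coeff_flow_riccati, omegaY, Y2, ← coeff_C_mul, Y12, neg_add,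
    ← map_neg]
  congr 1
  · simp only [phase, slope, Complex.ofReal_div, neg_mul, ← mul_div_assoc, neg_div]
    rfl
  · simp only [phase, neg_mul, map_mul, map_neg]
    change coeff s (-(C Complex.I * C (jv 0 0 p.1 : ℂ) * _)) =
      coeff s (C (1 / 2) * X * alphaSeries (η₂ (jy p.1)) *
        (-(C Complex.I * C (jv 0 0 p.1 : ℂ) * C (Complex.exp (theta 0 p)) * thetaSeries p ^ 2)
          + C Complex.I * C (jv 0 0 p.1 : ℂ) * C (Complex.exp (-theta 0 p))))
    ring_nf

lemma covDx_eq {n : ℕ} (f : Cov n → ℂ) (p : Cov n) :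
    covDx η₁ η₂ f p = lineDeriv ℝ f p (covField η₁ η₂ .x p) := by
  simp only [covDx, omegaX_eq_omegaCoeff]
  rfl

lemma covDy_eq {n : ℕ} (f : Cov n → ℂ) (p : Cov n) :
    covDy η₁ η₂ f p = lineDeriv ℝ f p (covField η₁ η₂ .y p) := by
  simp only [covDy, omegaY_eq_omegaCoeff]
  rfl

lemma hasDerivAt_coord_line (c : JetCoord) (p v : Jet) :
    HasDerivAt (fun t : ℝ => coord c (p + t • v)) (coord c v) 0 := by
  simp only [map_add, map_smul, smul_eq_mul]
  exact (((hasDerivAt_id (0 : ℝ)).mul_const _).const_add _).congr_deriv (one_mul _)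

lemma coord_fibre_zero_ne_zero {I J : Set ℝ} {p : Jet} (hp : p ∈ jetDomain η₁ η₂ I J) (a : Axis) :
    coord (fibre a 0 0) p ≠ 0 := by
  cases a
  exacts [hp.2.2.2.1, hp.2.2.2.2]

lemma coord_base_totalField_other (a : Axis) (p : Jet) :
    coord (base a) (totalField a.other p) = 0 := by
  cases a <;> rfl

lemma coord_base_totalField_self (a : Axis) (p : Jet) :
    coord (base a) (totalField a p) = 1 := by
  cases a <;> rfl

lemma hasDerivAt_slope {p : Jet} {a : Axis} (h : coord (fibre a.other 0 0) p ≠ 0) :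
    HasDerivAt (fun t : ℝ => slope a (p + t • totalField a.other p)) (slopeDeriv a p) 0 := by
  have hderiv := (hasDerivAt_coord_line (fibre a 0 1) p (totalField a.other p)).fun_div
    (hasDerivAt_coord_line (fibre a.other 0 0) p (totalField a.other p)) (by simpa using h)
  simpa [slope, slopeDeriv] using hderiv

namespace SmoothData

variable {I J : Set ℝ} (hd : SmoothData η₁ η₂ I J)
include hd

lemma contDiffAt_param {p : Jet} (hp : p ∈ jetDomain η₁ η₂ I J) (a : Axis) :
    ContDiffAt ℝ ∞ (param η₁ η₂ a) (coord (base a) p) := by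
  cases a
  exacts [hd.contDiffAt_left hp.1, hd.contDiffAt_right hp.2.1]

lemma hasDerivAt_eta {p : Jet} (hp : p ∈ jetDomain η₁ η₂ I J) (a : Axis) :
    HasDerivAt (fun t : ℝ => eta η₁ η₂ a (p + t • totalField a p)) (etaDeriv η₁ η₂ a p) 0 := by
  have hparam := ((hd.contDiffAt_param hp a).differentiableAt (by simp)).hasDerivAt
  have hcomp := hparam.comp_of_eq (0 : ℝ)
    (hasDerivAt_coord_line (base a) p (totalField a p)) (by simp)
  simpa [coord_base_totalField_self, eta, etaDeriv, Function.comp_def] using hcomp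

lemma hasRiccatiDeriv_connection {p : Jet} (hp : p ∈ jetDomain η₁ η₂ I J) (a : Axis) :
    HasRiccatiDeriv (fun t => connection η₁ η₂ a (p + t • totalField a.other p))
      (connectionDeriv η₁ η₂ a p) 0 := by
  have heta (t : ℝ) : eta η₁ η₂ a (p + t • totalField a.other p) = eta η₁ η₂ a p := by
    simp [eta, coord_base_totalField_other]
  have hfibre := (hasDerivAt_coord_line (fibre a 0 0) p (totalField a.other p)).ofReal_comp
  have hslope := (hasDerivAt_slope (coord_fibre_zero_ne_zero hp a.other)).ofReal_comp
  have hriccati := hasRiccatiDeriv_riccati (eta η₁ η₂ a p) (hd.hasDerivAt_eta hp a.other)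
    (hfibre.const_mul (phase a).1) (hslope.const_mul (phase a).2.1)
    (hfibre.const_mul (phase a).2.2)
  simpa [connection, connectionDeriv, heta] using hriccati

lemma hasDerivAt_omegaCoeff {n : ℕ} {p : Cov n} (hp : p.1 ∈ jetDomain η₁ η₂ I J) (a : Axis)
    (s : ℕ) :
    HasDerivAt (fun t : ℝ => omegaCoeff η₁ η₂ a s (p + t • covField η₁ η₂ a.other p))
      (coeff s (flow (connectionDeriv η₁ η₂ a p.1) p.2 + flowDeriv (connection η₁ η₂ a p.1) p.2
        (flowField n (connection η₁ η₂ a.other p.1) p.2))) 0 := by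
  have hθ : HasDerivAt
      (fun t : ℝ => p.2 + t • flowField n (connection η₁ η₂ a.other p.1) p.2)
      (flowField n (connection η₁ η₂ a.other p.1) p.2) 0 := by
    simpa using ((hasDerivAt_id (0 : ℝ)).smul_const _).const_add p.2
  simpa [omegaCoeff, covField] using (hd.hasRiccatiDeriv_connection hp a).flow hθ s

end SmoothData

section ZeroCurvature

variable {I J : Set ℝ} {p : Jet}

lemma coord_fibre_zero_one (hp : p ∈ jetDomain η₁ η₂ I J) (a : Axis) :
    coord (fibre a 0 1) p = coord (fibre a.other 0 0) p * slope a p :=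
  (mul_div_cancel₀ _ (coord_fibre_zero_ne_zero hp a.other)).symm

lemma coord_fibre_eq_rhs (hp : p ∈ equationManifold η₁ η₂ I J) (a : Axis) :
    coord (fibre a 0 2) p = rhs η₁ η₂ a p := by
  cases a
  exacts [sub_eq_zero.1 (hp.2 0 0).1, sub_eq_zero.1 (hp.2 0 0).2]

lemma slopeDeriv_mul_eta_sub (hp : p ∈ equationManifold η₁ η₂ I J) (a : Axis) :
    slopeDeriv a p * (eta η₁ η₂ a p - eta η₁ η₂ a.other p)
      = 1 / 2 * slope .x p * etaDeriv η₁ η₂ .y p + 1 / 2 * slope .y p * etaDeriv η₁ η₂ .x p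
        + ju 0 0 p * jv 0 0 p := by
  obtain ⟨-, -, hη, hu, hv⟩ := hp.1
  have hη := sub_ne_zero.2 hη
  have hη' := sub_ne_zero.2 hp.1.2.2.1.symm
  rw [slopeDeriv, coord_fibre_eq_rhs hp]
  cases a
  · change (rhs η₁ η₂ .x p * jv 0 0 p - ju 0 1 p * jv 0 1 p) / jv 0 0 p ^ 2
        * (η₁ (jx p) - η₂ (jy p))
      = 1 / 2 * (ju 0 1 p / jv 0 0 p) * deriv η₂ (jy p)
        + 1 / 2 * (jv 1 0 p / ju 0 0 p) * deriv η₁ (jx p) + ju 0 0 p * jv 0 0 p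
    rw [rhs]
    field_simp
    ring
  · change (rhs η₁ η₂ .y p * ju 0 0 p - jv 1 0 p * ju 1 0 p) / ju 0 0 p ^ 2
        * (η₂ (jy p) - η₁ (jx p))
      = 1 / 2 * (ju 0 1 p / jv 0 0 p) * deriv η₂ (jy p)
        + 1 / 2 * (jv 1 0 p / ju 0 0 p) * deriv η₁ (jx p) + ju 0 0 p * jv 0 0 p
    rw [rhs]
    field_simp
    ring

lemma slopeDeriv_y (hp : p ∈ equationManifold η₁ η₂ I J) :
    slopeDeriv .y p = -slopeDeriv .x p := by
  have hη : eta η₁ η₂ .x p - eta η₁ η₂ .y p ≠ 0 := sub_ne_zero.2 hp.1.2.2.1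
  have hx := slopeDeriv_mul_eta_sub hp .x
  have hy := slopeDeriv_mul_eta_sub hp .y
  simp only [Axis.other] at hx hy
  apply mul_right_cancel₀ hη
  linear_combination -hy + hx

lemma connectionDeriv_sub_connectionDeriv (hp : p ∈ equationManifold η₁ η₂ I J) :
    connectionDeriv η₁ η₂ .x p - connectionDeriv η₁ η₂ .y p
      = riccatiBracket (connection η₁ η₂ .x p) (connection η₁ η₂ .y p) := by
  have h := congrArg (fun r : ℝ => (r : ℂ)) (slopeDeriv_mul_eta_sub hp .x)
  push_cast at h
  have hcurvature := riccatiDeriv_sub_riccatiDeriv h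
  simp only [connectionDeriv, connection, phase, coord_fibre_zero_one hp.1, slopeDeriv_y hp,
    Axis.other, Complex.ofReal_mul, Complex.ofReal_neg, one_mul, neg_mul, mul_neg, neg_neg]
  exact hcurvature

end ZeroCurvature

end Connection

section SmoothFunctions

/-- The point of `Cov n` with given truncated coordinates, all other coordinates being zero. -/
def covExt {k n : ℕ} (z : ℝ × ℝ × (Fin k → Fin k → ℝ) × (Fin k → Fin k → ℝ) × (Fin n → ℂ)) :
    Cov n :=
  ((z.1, z.2.1, fun i j => if h : i < k ∧ j < k then z.2.2.1 ⟨i, h.1⟩ ⟨j, h.2⟩ else 0,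
    fun i j => if h : i < k ∧ j < k then z.2.2.2.1 ⟨i, h.1⟩ ⟨j, h.2⟩ else 0), z.2.2.2.2)

lemma isPlotAt_covExt {k n : ℕ}
    (z : ℝ × ℝ × (Fin k → Fin k → ℝ) × (Fin k → Fin k → ℝ) × (Fin n → ℂ)) :
    IsPlotAt (covExt (k := k) (n := n)) z := by
  refine .prodMk (isPlotAt_jet ?_) (isPlotAt_of_contDiffAt (by fun_prop))
  rintro ((_ | _) | ⟨_ | _, i, j⟩)
  · exact contDiffAt_fst
  · exact (contDiff_fst.comp contDiff_snd).contDiffAt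
  · simp only [coord, ContinuousLinearMap.comp_apply, ContinuousLinearMap.proj_apply,
      ContinuousLinearMap.coe_fst', ContinuousLinearMap.coe_snd']
    split_ifs <;> fun_prop
  · simp only [coord, ContinuousLinearMap.comp_apply, ContinuousLinearMap.proj_apply,
      ContinuousLinearMap.coe_snd']
    split_ifs <;> fun_prop

variable {k n : ℕ} {Ω : Set (Cov n)} {f : Cov n → ℂ}

lemma isSmooth_of_plotSmoothOn (hf : PlotSmoothOn Ω f)
    (hΩ : ∀ p ∈ Ω, covExt (truncate k n p) ∈ Ω)
    (hk : ∀ p ∈ Ω, f p = f (covExt (truncate k n p))) : IsSmooth Ω f := by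
  refine ⟨k, fun z => f (covExt z), ?_, hk⟩
  rintro _ ⟨p, hp, rfl⟩
  exact (hf.contDiffAt_comp (isPlotAt_covExt _) (hΩ p hp)).contDiffWithinAt

lemma IsPlotAt.coord_fst {E : Type} [NormedAddCommGroup E] [NormedSpace ℝ E] {γ : E → Cov n}
    {e : E} (hγ : IsPlotAt γ e) (c : JetCoord) : ContDiffAt ℝ ∞ (fun z => coord c (γ z).1) e :=
  hγ ((coord c).comp (.fst ℝ _ _))

lemma IsPlotAt.contDiffAt_truncate {E : Type} [NormedAddCommGroup E] [NormedSpace ℝ E]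
    {γ : E → Cov n} {e : E} (hγ : IsPlotAt γ e) :
    ContDiffAt ℝ ∞ (fun z => truncate k n (γ z)) e :=
  (hγ.coord_fst (base .x)).prodMk <| (hγ.coord_fst (base .y)).prodMk <| .prodMk
    (contDiffAt_pi.2 fun i => contDiffAt_pi.2 fun j => hγ.coord_fst (fibre .x i j)) <| .prodMk
    (contDiffAt_pi.2 fun i => contDiffAt_pi.2 fun j => hγ.coord_fst (fibre .y j i))
    (hγ.map (.snd ℝ _ _)).contDiffAt

lemma IsSmooth.plotSmoothOn (hf : IsSmooth Ω f) (hΩ : PlotOpen Ω) : PlotSmoothOn Ω f := by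
  obtain ⟨k, F, hF, hfF⟩ := hf
  intro E _ _ γ e hγ he
  have hmem : γ ⁻¹' Ω ∈ 𝓝 e := hΩ hγ he
  have hmaps : Set.MapsTo (fun z => truncate k n (γ z)) (γ ⁻¹' Ω) (truncate k n '' Ω) :=
    fun z hz => ⟨γ z, hz, rfl⟩
  have hcomp := (hF _ ⟨γ e, he, rfl⟩).comp e hγ.contDiffAt_truncate.contDiffWithinAt hmaps
  exact isPlotAt_of_contDiffAt <|
    (hcomp.contDiffAt hmem).congr_of_eventuallyEq (Filter.mem_of_superset hmem fun z hz => hfF _ hz)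

lemma sModEq_prod_bot {V W : Type*} [AddCommGroup V] [Module ℝ V] [AddCommGroup W] [Module ℝ W]
    {K : Submodule ℝ V} {p q : V × W} :
    p ≡ q [SMOD K.prod ⊥] ↔ p.1 ≡ q.1 [SMOD K] ∧ p.2 = q.2 := by
  simp [SModEq.sub_mem, sub_eq_zero]

lemma IsSmooth.exists_invariantOn (hf : IsSmooth Ω f) :
    ∃ M, InvariantOn Ω ((coords (levelLE M)).ker.prod ⊥) f := by
  obtain ⟨k, F, -, hfF⟩ := hf
  refine ⟨2 * k, fun p hp q hq hpq => ?_⟩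
  obtain ⟨hcoord, hθ⟩ := sModEq_prod_bot.1 hpq
  rw [sModEq_ker_coords] at hcoord
  have hlevel (i j : Fin k) : (i : ℕ) + j + 1 ≤ 2 * k := by omega
  have htrunc : truncate k n p = truncate k n q :=
    Prod.ext (hcoord (base .x) (Nat.zero_le _)) <|
      Prod.ext (hcoord (base .y) (Nat.zero_le _)) <| Prod.ext
      (funext fun i => funext fun j => hcoord (fibre .x i j) (hlevel i j)) <| Prod.ext
      (funext fun i => funext fun j => hcoord (fibre .y j i) (hlevel j i)) hθ
  rw [hfF p hp, hfF q hq, htrunc]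

end SmoothFunctions

section ConservationLaw

variable {η₁ η₂ : ℝ → ℝ} {I J : Set ℝ}

lemma connection_congr {p q : Jet} (a : Axis) (hbase : ∀ b, coord (base b) p = coord (base b) q)
    (hfibre : ∀ b, coord (fibre b 0 0) p = coord (fibre b 0 0) q)
    (hderiv : coord (fibre a 0 1) p = coord (fibre a 0 1) q) :
    connection η₁ η₂ a p = connection η₁ η₂ a q := by
  simp only [connection, eta, slope, hbase, hfibre, hderiv]

lemma small_connection (a : Axis) (p : Jet) : (connection η₁ η₂ a p).Small :=
  small_riccati _ _ _ _ _

namespace SmoothData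

variable (hd : SmoothData η₁ η₂ I J)
include hd

lemma plotOpen_covDomain (n : ℕ) : PlotOpen (covDomain η₁ η₂ I J n) :=
  fun _ _ _ _ _ hγ he => hd.plotOpen_jetDomain (hγ.map (.fst ℝ _ _)) he

lemma plotSmoothOn_omegaCoeff (a : Axis) (s n : ℕ) :
    PlotSmoothOn (covDomain η₁ η₂ I J n) (omegaCoeff η₁ η₂ a s) := by
  intro E _ _ γ e hγ he
  have heta (b : Axis) : ContDiffAt ℝ ∞ (fun z => eta η₁ η₂ b (γ z).1) e :=
    (hd.contDiffAt_param he b).comp e (hγ.coord_fst (base b))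
  have hreal {g : E → ℝ} (hg : ContDiffAt ℝ ∞ g e) : ContDiffAt ℝ ∞ (fun z => (g z : ℂ)) e :=
    Complex.ofRealCLM.contDiff.contDiffAt.comp e hg
  have hfibre := hreal (hγ.coord_fst (fibre a 0 0))
  have hslope := hreal <| (hγ.coord_fst (fibre a 0 1)).fun_div (hγ.coord_fst (fibre a.other 0 0))
    (coord_fibre_zero_ne_zero he a.other)
  have halpha := (seriesSmoothAt_const (C (1 / 2) * X)).mul
    (seriesSmoothAt_powSeries (heta a) (-1 / 2))
  have hratio := (seriesSmoothAt_powSeries (heta a.other) (1 / 2)).mul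
    (seriesSmoothAt_powSeries (heta a) (-1 / 2))
  exact isPlotAt_of_contDiffAt <| seriesSmoothAt_flow
    (R := fun z => connection η₁ η₂ a (γ z).1)
    ((seriesSmoothAt_C (contDiffAt_const.mul hfibre)).mul halpha)
    ((seriesSmoothAt_C (contDiffAt_const.mul hslope)).mul hratio)
    ((seriesSmoothAt_C (contDiffAt_const.mul hfibre)).mul halpha)
    (hγ.map (.snd ℝ _ _)).contDiffAt s

lemma isSmooth_omegaCoeff (a : Axis) (s n : ℕ) :
    IsSmooth (covDomain η₁ η₂ I J n) (omegaCoeff η₁ η₂ a s) := by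
  refine isSmooth_of_plotSmoothOn (k := 2) (hd.plotSmoothOn_omegaCoeff a s n) (fun _ hp => hp)
    fun p _ => ?_
  have hconnection : connection η₁ η₂ a p.1 = connection η₁ η₂ a (covExt (truncate 2 n p)).1 := by
    refine connection_congr a ?_ ?_ ?_
    · rintro (_ | _) <;> rfl
    · rintro (_ | _) <;> rfl
    · cases a <;> rfl
  rw [omegaCoeff, hconnection]
  rfl

/-- The zero curvature condition of the two Riccati equations, read coefficientwise. -/
lemma lineDeriv_omegaCoeff_comm {s n : ℕ} (hs : s ≤ n) {p : Cov n}
    (hp : p ∈ covEquation η₁ η₂ I J n) :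
    lineDeriv ℝ (omegaCoeff η₁ η₂ .x s) p (covField η₁ η₂ .y p)
      = lineDeriv ℝ (omegaCoeff η₁ η₂ .y s) p (covField η₁ η₂ .x p) := by
  have hcurvature := connectionDeriv_sub_connectionDeriv hp
  have hsmall (a : Axis) : (connection η₁ η₂ a p.1).Small := small_connection a p.1
  have hcomm := coeff_flowDeriv_sub (hsmall .x) (hsmall .y) p.2 hs
  rw [← hcurvature, flow_sub, map_sub] at hcomm
  have hx := (hd.hasDerivAt_omegaCoeff hp.1 .x s).deriv
  have hy := (hd.hasDerivAt_omegaCoeff hp.1 .y s).deriv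
  rw [lineDeriv, lineDeriv]
  simp only [Axis.other, map_add] at hx hy
  rw [hx, hy]
  linear_combination -hcomm

lemma isConservationLaw_omega (s : ℕ) :
    IsConservationLaw η₁ η₂ I J (n := s) (omegaX η₁ η₂ s) (omegaY η₁ η₂ s) := by
  rw [funext (omegaX_eq_omegaCoeff s), funext (omegaY_eq_omegaCoeff s)]
  refine ⟨hd.isSmooth_omegaCoeff .x s s, hd.isSmooth_omegaCoeff .y s s, fun p hp => ?_⟩
  rw [covDy_eq, covDx_eq, hd.lineDeriv_omegaCoeff_comm le_rfl hp]

end SmoothData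

end ConservationLaw

section Potential

variable {η₁ η₂ : ℝ → ℝ} {I J : Set ℝ} {n : ℕ}

/-- A smooth function on the whole of `covDomain` whose horizontal differential is `ω_n` at the
points of the covering equation. -/
structure IsPotential (η₁ η₂ : ℝ → ℝ) (I J : Set ℝ) (h : Cov n → ℂ) : Prop where
  plotSmoothOn : PlotSmoothOn (covDomain η₁ η₂ I J n) h
  lineDeriv_covField : ∀ a, ∀ p ∈ covEquation η₁ η₂ I J n,
    lineDeriv ℝ h p (covField η₁ η₂ a p) = omegaCoeff η₁ η₂ a n p

/-- Replace the jet coordinates by those of the point of the equation with the same parametric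
coordinates. -/
def covNormal (η₁ η₂ : ℝ → ℝ) (p : Cov n) : Cov n := (jetNormal η₁ η₂ p.1, p.2)

/-- The displacements which leave fixed the nonlocal variables and the parametric coordinates of
level at most `M`. -/
def fixParametric (n M : ℕ) : Submodule ℝ (Cov n) := (coords (knownLE 0 M)).ker.prod ⊥

lemma covNormal_sModEq_self (M : ℕ) (p : Cov n) :
    covNormal η₁ η₂ p ≡ p [SMOD fixParametric n M] :=
  sModEq_prod_bot.2 ⟨jetNormal_sModEq_self M p.1, rfl⟩

namespace SmoothData

variable (hd : SmoothData η₁ η₂ I J)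
include hd

lemma lineDeriv_comp_covNormal {f : Cov n → ℂ} (hf : IsSmooth (covDomain η₁ η₂ I J n) f)
    {p : Cov n} (hp : p ∈ covEquation η₁ η₂ I J n) (a : Axis) :
    lineDeriv ℝ (fun q => f (covNormal η₁ η₂ q)) p (covField η₁ η₂ a p)
      = lineDeriv ℝ f p (covField η₁ η₂ a p) := by
  obtain ⟨M, hinv⟩ := hf.exists_invariantOn
  have : Finite (levelLE M) := finite_levelLE M
  have : Fintype (levelLE M) := Fintype.ofFinite _
  set v := covField η₁ η₂ a p
  let γ (t : ℝ) : Cov n := covNormal η₁ η₂ (p + t • v)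
  have hline : p + (0 : ℝ) • v = p := by rw [zero_smul, add_zero]
  have hγ0 : γ 0 = p := by
    simp only [γ, hline]
    exact Prod.ext (hd.jetNormal_eq_self hp) rfl
  have hdom : (p + (0 : ℝ) • v).1 ∈ jetDomain η₁ η₂ I J := hline.symm ▸ hp.1
  have hplot : IsPlotAt γ 0 := .prodMk
    (hd.plotSmoothOn_jetNormal ((isPlotAt_line p v 0).map (.fst ℝ _ _)) hdom)
    ((isPlotAt_line p v 0).map (.snd ℝ _ _))
  have hderiv : HasDerivAt (fun t => (coords (levelLE M)).prodMap LinearMap.id (γ t))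
      ((coords (levelLE M)).prodMap LinearMap.id v) 0 := by
    have hθ : HasDerivAt (fun t : ℝ => p.2 + t • v.2) v.2 0 := by
      simpa using ((hasDerivAt_id (0 : ℝ)).smul_const v.2).const_add p.2
    exact .prodMk (hasDerivAt_pi.2 fun c => hd.hasDerivAt_coord_jetNormal hp a c) hθ
  have hchain := (hf.plotSmoothOn (hd.plotOpen_covDomain n)).hasDerivAt_comp
    (hd.plotOpen_covDomain n) (π := (coords (levelLE M)).prodMap LinearMap.id)
    (by rwa [LinearMap.ker_prodMap, LinearMap.ker_id]) hplot (hγ0.symm ▸ hp.1) hderiv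
  rw [hγ0] at hchain
  exact hchain.deriv

lemma exists_isPotential
    (h : IsTrivialForm η₁ η₂ I J (n := n) (omegaX η₁ η₂ n) (omegaY η₁ η₂ n)) :
    ∃ (g : Cov n → ℂ) (M : ℕ), IsPotential η₁ η₂ I J g ∧
      InvariantOn (covDomain η₁ η₂ I J n) (fixParametric n M) g := by
  obtain ⟨f, hf, hform⟩ := h
  obtain ⟨M, hinv⟩ := hf.exists_invariantOn
  have hnormal {p : Cov n} (hp : p ∈ covDomain η₁ η₂ I J n) :
      covNormal η₁ η₂ p ∈ covDomain η₁ η₂ I J n := jetNormal_mem_jetDomain hp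
  refine ⟨fun p => f (covNormal η₁ η₂ p), M, ⟨?_, fun a p hp => ?_⟩, ?_⟩
  · exact fun E _ _ γ e hγ he => hf.plotSmoothOn (hd.plotOpen_covDomain n)
      (.prodMk (hd.plotSmoothOn_jetNormal (hγ.map (.fst ℝ _ _)) he) (hγ.map (.snd ℝ _ _)))
      (hnormal he)
  · rw [hd.lineDeriv_comp_covNormal hf hp]
    cases a
    · rw [← covDx_eq, (hform p hp).1, omegaX_eq_omegaCoeff]
    · rw [← covDy_eq, (hform p hp).2, omegaY_eq_omegaCoeff]
  · intro p hp q hq hpq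
    have hpq := sModEq_prod_bot.1 hpq
    exact hinv (hnormal hp) (hnormal hq)
      (sModEq_prod_bot.2 ⟨hd.jetNormal_sModEq hp hq hpq.1, hpq.2⟩)

end SmoothData

end Potential

section Elimination

variable {η₁ η₂ : ℝ → ℝ} {I J : Set ℝ} {n M : ℕ} {h : Cov n → ℂ}

/-- The part of the covering where `u` and `v` are positive. Unlike `covDomain`, its sections at
fixed `x` and `y` are convex. -/
def positiveDomain (η₁ η₂ : ℝ → ℝ) (I J : Set ℝ) (n : ℕ) : Set (Cov n) :=
  {p | p ∈ covDomain η₁ η₂ I J n ∧ ∀ a, 0 < coord (fibre a 0 0) p.1}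

lemma mem_positiveDomain_of_base_eq {p q : Cov n} (hq : q ∈ positiveDomain η₁ η₂ I J n)
    (hbase : ∀ a, coord (base a) p.1 = coord (base a) q.1)
    (hpos : ∀ a, 0 < coord (fibre a 0 0) p.1) : p ∈ positiveDomain η₁ η₂ I J n := by
  have hx : jx p.1 = jx q.1 := hbase .x
  have hy : jy p.1 = jy q.1 := hbase .y
  obtain ⟨⟨hqx, hqy, hη, -, -⟩, -⟩ := hq
  exact ⟨⟨hx ▸ hqx, hy ▸ hqy, hx ▸ hy ▸ hη, (hpos .x).ne', (hpos .y).ne'⟩, hpos⟩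

lemma mem_positiveDomain_of_sModEq {p q : Cov n} (hq : q ∈ positiveDomain η₁ η₂ I J n)
    (h : p ≡ q [SMOD fixParametric n (M + 1)]) : p ∈ positiveDomain η₁ η₂ I J n := by
  have hcoord := sModEq_ker_coords.1 (sModEq_prod_bot.1 h).1
  refine mem_positiveDomain_of_base_eq hq (fun a => hcoord (base a) ⟨Nat.zero_le _, .inl trivial⟩)
    fun a => ?_
  rw [hcoord (fibre a 0 0) ⟨Nat.le_add_left 1 M, .inl Nat.zero_lt_two⟩]
  exact hq.2 a

lemma IsPotential.lineDeriv_eq_sub {D : Set (Cov n)} {K : Submodule ℝ (Cov n)} {p q w : Cov n}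
    {a : Axis} (hpot : IsPotential η₁ η₂ I J h) (hD : PlotOpen D) (hinv : InvariantOn D K h)
    (hpD : p ∈ D) (hqD : q ∈ D) (hp : p ∈ covEquation η₁ η₂ I J n)
    (hq : q ∈ covEquation η₁ η₂ I J n) (hpq : p ≡ q [SMOD K])
    (hw : w ≡ covField η₁ η₂ a q - covField η₁ η₂ a p [SMOD K]) :
    lineDeriv ℝ h p w = omegaCoeff η₁ η₂ a n q - omegaCoeff η₁ η₂ a n p := by
  have hfield : covField η₁ η₂ a p + w ≡ covField η₁ η₂ a q [SMOD K] := by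
    simpa using (SModEq.refl (covField η₁ η₂ a p)).add hw
  rw [← hpot.lineDeriv_covField a q hq, ← hpot.lineDeriv_covField a p hp,
    ← hinv.lineDeriv_eq hD hpD hqD hpq hfield, hpot.plotSmoothOn.lineDeriv_add hp.1,
    add_sub_cancel_left]

/-- The jet obtained from the parametric coordinates of `v` along one axis by raising the order of
each derivative along this axis. -/
def raise (a : Axis) (v : Jet) : Jet :=
  ofCoord fun
    | fibre b (i + 1) j => if b = a ∧ j < 2 then coord (fibre a i j) v else 0
    | _ => 0

/-- The change of `totalField a` when `raise a v` is added to the jet. -/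
def raisedField (a : Axis) (v : Jet) : Jet := totalField a (raise a v) - totalField a 0

lemma coord_raise_of_not_isParametric (a : Axis) (v : Jet) {c : JetCoord}
    (hc : ¬ c.IsParametric) : coord c (raise a v) = 0 := by
  rcases c with b | ⟨b, _ | i, j⟩
  · exact absurd trivial hc
  · simp [raise]
  · have hj : ¬ j < 2 := hc
    simp only [raise, coord_ofCoord, hj, and_false, if_false]

lemma coord_fibre_zero_raise (a b : Axis) (j : ℕ) (v : Jet) :
    coord (fibre b 0 j) (raise a v) = 0 := by
  simp [raise]

lemma raise_sModEq_zero {v : Jet} (hv : v ≡ 0 [SMOD (coords (knownLE 0 M)).ker]) (a : Axis) :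
    raise a v ≡ 0 [SMOD (coords (knownLE 0 (M + 1))).ker] := by
  rw [sModEq_ker_coords] at hv ⊢
  rintro (b | ⟨b, _ | i, j⟩) ⟨hlevel, -⟩
  · simp [raise]
  · simp [raise]
  · simp only [raise, coord_ofCoord, map_zero, ite_eq_right_iff, and_imp]
    intro _ hj
    simp only [level] at hlevel
    simpa using hv (fibre a i j) ⟨by simp only [level]; omega, .inl hj⟩

lemma coord_base_raisedField (a b : Axis) (v : Jet) : coord (base b) (raisedField a v) = 0 := by
  rw [raisedField, map_sub, coord_base_totalField b a _ 0, sub_self]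

lemma coord_fibre_raisedField_self (a : Axis) (v : Jet) (i : ℕ) {j : ℕ} (hj : j < 2) :
    coord (fibre a i j) (raisedField a v) = coord (fibre a i j) v := by
  simp only [raisedField, map_sub, coord_fibre_totalField, raise, coord_ofCoord, hj, and_self,
    if_true, map_zero, sub_zero]

lemma coord_fibre_raisedField_other (a : Axis) (v : Jet) (i j : ℕ) :
    coord (fibre a i j) (raisedField a.other v) = 0 := by
  have hne : a ≠ a.other := by cases a <;> simp [Axis.other]
  cases i <;> simp [raisedField, raise, hne]

lemma raisedField_add_raisedField_sModEq {v : Jet} (hv : ∀ b, coord (base b) v = 0) (M : ℕ) :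
    raisedField .x v + raisedField .y v ≡ v [SMOD (coords (knownLE 0 M)).ker] := by
  rw [sModEq_ker_coords]
  rintro (b | ⟨b, i, j⟩) ⟨-, hc⟩
  · simp [coord_base_raisedField, hv]
  · have hj : j < 2 := hc.elim id fun hc => absurd hc (by simp [level])
    have hx := coord_fibre_raisedField_other .x v i j
    have hy := coord_fibre_raisedField_other .y v i j
    cases b
    · rw [map_add, coord_fibre_raisedField_self .x v i hj]
      exact (congrArg _ hx).trans (add_zero _)
    · rw [map_add, coord_fibre_raisedField_self .y v i hj]
      exact (congrArg (· + _) hy).trans (zero_add _)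

lemma add_smul_raisedField_mem {p q : Cov n} (hp : p ∈ positiveDomain η₁ η₂ I J n)
    (hq : q ∈ positiveDomain η₁ η₂ I J n) {r : Cov n} (hr : r ∈ positiveDomain η₁ η₂ I J n)
    (a : Axis) {t : ℝ} (ht : t ∈ Set.Icc (0 : ℝ) 1)
    (hra : coord (fibre a 0 0) r.1 = coord (fibre a 0 0) p.1) :
    r + t • ((raisedField a (q.1 - p.1), 0) : Cov n) ∈ positiveDomain η₁ η₂ I J n := by
  refine mem_positiveDomain_of_base_eq hr (fun b => ?_) fun b => ?_
  · simp [coord_base_raisedField]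
  obtain rfl | rfl := b.eq_or_eq_other a
  · have hconvex : 0 < (1 - t) • coord (fibre a 0 0) p.1 + t • coord (fibre a 0 0) q.1 :=
      convex_Ioi (0 : ℝ) (hp.2 a) (hq.2 a) (sub_nonneg.2 ht.2) ht.1 (sub_add_cancel 1 t)
    simp only [Prod.fst_add, Prod.smul_fst, map_add, map_smul, map_sub,
      coord_fibre_raisedField_self _ _ _ Nat.zero_lt_two, hra]
    simp only [smul_eq_mul] at hconvex ⊢
    linarith
  · simpa [coord_fibre_raisedField_other] using hr.2 b

namespace SmoothData

variable (hd : SmoothData η₁ η₂ I J)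
include hd

lemma plotOpen_positiveDomain : PlotOpen (positiveDomain η₁ η₂ I J n) := by
  intro E _ _ γ e hγ he
  have hpos (a : Axis) : ∀ᶠ z in 𝓝 e, 0 < coord (fibre a 0 0) (γ z).1 :=
    (hγ.coord_fst (fibre a 0 0)).continuousAt.eventually_const_lt (he.2 a)
  filter_upwards [hd.plotOpen_covDomain n hγ he.1, hpos .x, hpos .y] with z hz hx hy
  exact ⟨hz, fun a => by cases a <;> assumption⟩

lemma coord_jetNormal_eq_of_not_isParametric {p q : Jet} (hp : p ∈ jetDomain η₁ η₂ I J)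
    (hq : q ∈ jetDomain η₁ η₂ I J) (h : p ≡ q [SMOD (coords (knownLE 0 M)).ker]) {c : JetCoord}
    (hc : ¬ c.IsParametric) (hlevel : c.level ≤ M + 1) :
    coord c (jetNormal η₁ η₂ p) = coord c (jetNormal η₁ η₂ q) := by
  rcases c with a | ⟨a, m, _ | _ | k⟩
  · exact absurd trivial hc
  · exact absurd Nat.zero_lt_two hc
  · exact absurd Nat.one_lt_two hc
  · rw [eqnStep_eq_self_iff.1 (hd.eqnStep_jetNormal hp),
      eqnStep_eq_self_iff.1 (hd.eqnStep_jetNormal hq)]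
    refine hd.invariantOn_prolong a m k (jetNormal_mem_jetDomain hp) (jetNormal_mem_jetDomain hq)
      ((hd.jetNormal_sModEq hp hq h).mono (ker_coords_anti (levelLE_mono ?_)))
    simp only [level] at hlevel
    omega

lemma coord_jetNormal_add_raise {p v : Jet} (hp : p ∈ jetDomain η₁ η₂ I J) {a : Axis}
    (hpv : p + raise a v ∈ jetDomain η₁ η₂ I J)
    (h : p + raise a v ≡ p [SMOD (coords (knownLE 0 M)).ker]) {c : JetCoord}
    (hlevel : c.level ≤ M + 1) :
    coord c (jetNormal η₁ η₂ (p + raise a v))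
      = coord c (jetNormal η₁ η₂ p) + coord c (raise a v) := by
  by_cases hc : c.IsParametric
  · have hself (q : Jet) : coord c (jetNormal η₁ η₂ q) = coord c q :=
      sModEq_ker_coords.1 (jetNormal_sModEq_self c.level q) c ⟨le_rfl, .inl hc⟩
    rw [hself, hself, map_add]
  · rw [hd.coord_jetNormal_eq_of_not_isParametric hpv hp h hc hlevel,
      coord_raise_of_not_isParametric a v hc, add_zero]

lemma totalField_jetNormal_add_raise_sub {p v : Jet} (hp : p ∈ jetDomain η₁ η₂ I J) {a : Axis}
    (hpv : p + raise a v ∈ jetDomain η₁ η₂ I J)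
    (h : p + raise a v ≡ p [SMOD (coords (knownLE 0 (M + 1))).ker]) :
    totalField a (jetNormal η₁ η₂ (p + raise a v)) - totalField a (jetNormal η₁ η₂ p)
      ≡ raisedField a v [SMOD (coords (knownLE 0 (M + 1))).ker] := by
  rw [sModEq_ker_coords]
  rintro (b | ⟨b, i, j⟩) ⟨hlevel, -⟩
  · rw [map_sub, coord_base_totalField b a _ (jetNormal η₁ η₂ p), sub_self,
      coord_base_raisedField]
  simp only [level] at hlevel
  obtain rfl | rfl := b.eq_or_eq_other a
  · simp only [raisedField, map_sub, coord_fibre_totalField, map_zero, sub_zero]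
    rw [hd.coord_jetNormal_add_raise hp hpv h (by simp only [level]; omega), add_sub_cancel_left]
  · simp only [raisedField, map_sub, coord_fibre_totalField_other, map_zero, sub_zero]
    rw [hd.coord_jetNormal_add_raise hp hpv h (by simp only [level]; omega), add_sub_cancel_left]

lemma connection_jetNormal_add_raise {p v : Jet} (hp : p ∈ jetDomain η₁ η₂ I J) {a : Axis}
    (hpv : p + raise a v ∈ jetDomain η₁ η₂ I J)
    (h : p + raise a v ≡ p [SMOD (coords (knownLE 0 (M + 1))).ker]) :
    connection η₁ η₂ a (jetNormal η₁ η₂ (p + raise a v))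
      = connection η₁ η₂ a (jetNormal η₁ η₂ p) := by
  have hcoord {c : JetCoord} (hlevel : c.level ≤ 2) (hc : coord c (raise a v) = 0) :
      coord c (jetNormal η₁ η₂ (p + raise a v)) = coord c (jetNormal η₁ η₂ p) := by
    rw [hd.coord_jetNormal_add_raise hp hpv h (hlevel.trans (Nat.le_add_left 2 M)), hc, add_zero]
  exact connection_congr a (fun b => hcoord (c := base b) (Nat.zero_le 2) (by simp [raise]))
    (fun b => hcoord (c := fibre b 0 0) one_le_two (coord_fibre_zero_raise a b 0 v))
    (hcoord (c := fibre a 0 1) le_rfl (coord_fibre_zero_raise a a 1 v))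

/-- Adding `raise a v` to the jet changes `covField a` by `raisedField a v` and leaves `ω_n`
unchanged along the axis `a`. -/
lemma lineDeriv_raisedField_eq_zero (hpot : IsPotential η₁ η₂ I J h)
    (hinv : InvariantOn (positiveDomain η₁ η₂ I J n) (fixParametric n (M + 1)) h) {p : Cov n}
    (hp : p ∈ positiveDomain η₁ η₂ I J n) {v : Jet} (hv : v ≡ 0 [SMOD (coords (knownLE 0 M)).ker])
    (a : Axis) : lineDeriv ℝ h p (raisedField a v, 0) = 0 := by
  set q : Cov n := (p.1 + raise a v, p.2)
  have hqp : q.1 ≡ p.1 [SMOD (coords (knownLE 0 (M + 1))).ker] := by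
    simpa using (SModEq.refl p.1).add (raise_sModEq_zero hv a)
  have hq : q ∈ positiveDomain η₁ η₂ I J n :=
    mem_positiveDomain_of_sModEq hp (sModEq_prod_bot.2 ⟨hqp, rfl⟩)
  have hpP : covNormal η₁ η₂ p ≡ p [SMOD fixParametric n (M + 1)] := covNormal_sModEq_self _ p
  have hqQ : covNormal η₁ η₂ q ≡ q [SMOD fixParametric n (M + 1)] := covNormal_sModEq_self _ q
  have hP := mem_positiveDomain_of_sModEq hp hpP
  have hQ := mem_positiveDomain_of_sModEq hq hqQ
  have hPQ : covNormal η₁ η₂ p ≡ covNormal η₁ η₂ q [SMOD fixParametric n (M + 1)] :=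
    hpP.trans ((sModEq_prod_bot.2 ⟨hqp, rfl⟩ : q ≡ p [SMOD _]).symm.trans hqQ.symm)
  have hconnection : connection η₁ η₂ a (covNormal η₁ η₂ q).1
      = connection η₁ η₂ a (covNormal η₁ η₂ p).1 :=
    hd.connection_jetNormal_add_raise hp.1 hq.1 hqp
  have hfield : (raisedField a v, 0) ≡ covField η₁ η₂ a (covNormal η₁ η₂ q)
      - covField η₁ η₂ a (covNormal η₁ η₂ p) [SMOD fixParametric n (M + 1)] := by
    refine sModEq_prod_bot.2 ⟨(hd.totalField_jetNormal_add_raise_sub hp.1 hq.1 hqp).symm, ?_⟩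
    simp only [covField, hconnection, Prod.snd_sub]
    exact (sub_self _).symm
  rw [← hinv.lineDeriv_eq hd.plotOpen_positiveDomain hP hp hpP (SModEq.refl _),
    hpot.lineDeriv_eq_sub hd.plotOpen_positiveDomain hinv hP hQ (hd.jetNormal_mem hp.1)
      (hd.jetNormal_mem hq.1) hPQ hfield, omegaCoeff, omegaCoeff, hconnection]
  exact sub_self _

/-- The displacement `q - p` is a sum of a raised field along each axis, and `h` is constant along
both. -/
lemma invariantOn_of_succ (hpot : IsPotential η₁ η₂ I J h)
    (hinv : InvariantOn (positiveDomain η₁ η₂ I J n) (fixParametric n (M + 1)) h) :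
    InvariantOn (positiveDomain η₁ η₂ I J n) (fixParametric n M) h := by
  intro p hp q hq hpq
  obtain ⟨hjet, hθ⟩ := sModEq_prod_bot.1 hpq
  set v : Jet := q.1 - p.1
  have hv : v ≡ 0 [SMOD (coords (knownLE 0 M)).ker] := by
    simpa [v] using hjet.symm.sub (SModEq.refl p.1)
  have hvbase (b : Axis) : coord (base b) v = 0 := by
    simpa using sModEq_ker_coords.1 hv (base b) ⟨Nat.zero_le M, .inl trivial⟩
  set wx : Cov n := (raisedField .x v, 0)
  set wy : Cov n := (raisedField .y v, 0)
  have hx (t : ℝ) (ht : t ∈ Set.Icc (0 : ℝ) 1) : p + t • wx ∈ positiveDomain η₁ η₂ I J n :=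
    add_smul_raisedField_mem hp hq hp .x ht rfl
  have hpx : p + wx ∈ positiveDomain η₁ η₂ I J n := by simpa using hx 1 (by simp)
  have hy (t : ℝ) (ht : t ∈ Set.Icc (0 : ℝ) 1) : p + wx + t • wy ∈ positiveDomain η₁ η₂ I J n := by
    refine add_smul_raisedField_mem hp hq hpx .y ht ?_
    have hzero := coord_fibre_raisedField_other .y v 0 0
    exact (map_add _ _ _).trans ((congrArg _ hzero).trans (add_zero _))
  have hpxy : p + wx + wy ∈ positiveDomain η₁ η₂ I J n := by simpa using hy 1 (by simp)
  have hsum : p + wx + wy ≡ q [SMOD fixParametric n (M + 1)] := by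
    refine sModEq_prod_bot.2 ⟨?_, by simp [wx, wy, hθ]⟩
    simpa [v, add_assoc, wx, wy] using
      (SModEq.refl p.1).add (raisedField_add_raisedField_sModEq hvbase (M + 1))
  have hsmooth : PlotSmoothOn (positiveDomain η₁ η₂ I J n) h :=
    fun _ _ _ _ _ hγ he => hpot.plotSmoothOn hγ he.1
  calc h p = h (p + wx) := (hsmooth.eq_of_lineDeriv_eq_zero hx fun t ht =>
        hd.lineDeriv_raisedField_eq_zero hpot hinv (hx t ht) hv .x).symm
    _ = h (p + wx + wy) := (hsmooth.eq_of_lineDeriv_eq_zero hy fun t ht =>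
        hd.lineDeriv_raisedField_eq_zero hpot hinv (hy t ht) hv .y).symm
    _ = h q := hinv hpxy hq hsum

lemma invariantOn_fixParametric_zero (hpot : IsPotential η₁ η₂ I J h)
    (hinv : InvariantOn (positiveDomain η₁ η₂ I J n) (fixParametric n M) h) :
    InvariantOn (positiveDomain η₁ η₂ I J n) (fixParametric n 0) h := by
  induction M with
  | zero => exact hinv
  | succ M ih => exact ih (hd.invariantOn_of_succ hpot hinv)

end SmoothData

end Elimination

section Nontriviality

variable {η₁ η₂ : ℝ → ℝ} {I J : Set ℝ} {n : ℕ} {h : Cov n → ℂ}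

lemma isPlotAt_prodMk_left (p : Jet) (θ : Fin n → ℂ) :
    IsPlotAt (fun θ : Fin n → ℂ => ((p, θ) : Cov n)) θ :=
  .prodMk (isPlotAt_const p θ) (isPlotAt_of_contDiffAt contDiffAt_id)

lemma PlotSmoothOn.fderiv_prodMk_left {D : Set (Cov n)} (hh : PlotSmoothOn D h) {p : Jet}
    {θ : Fin n → ℂ} (hp : (p, θ) ∈ D) (w : Fin n → ℂ) :
    fderiv ℝ (fun θ => h (p, θ)) θ w = lineDeriv ℝ h (p, θ) (0, w) := by
  have hdiff : DifferentiableAt ℝ (fun θ => h (p, θ)) θ :=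
    (hh.contDiffAt_comp (isPlotAt_prodMk_left p θ) hp).differentiableAt (by simp)
  rw [← hdiff.lineDeriv_eq_fderiv]
  simp [_root_.lineDeriv]

namespace SmoothData

variable (hd : SmoothData η₁ η₂ I J)
include hd

lemma lifts_connection_sub (hpot : IsPotential η₁ η₂ I J h)
    (hinv : InvariantOn (positiveDomain η₁ η₂ I J n) (fixParametric n 0) h) {p q : Jet}
    (hp : p ∈ equationManifold η₁ η₂ I J) (hq : q ∈ equationManifold η₁ η₂ I J)
    (hp_pos : ∀ a, 0 < coord (fibre a 0 0) p) (hq_pos : ∀ a, 0 < coord (fibre a 0 0) q)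
    (hpq : p ≡ q [SMOD (coords (knownLE 0 0)).ker]) (a : Axis) :
    Lifts (fun θ => h (p, θ)) (connection η₁ η₂ a q - connection η₁ η₂ a p) := by
  have hsmall (r : Jet) : (connection η₁ η₂ a r).Small := small_connection a r
  refine ⟨⟨by simp [(hsmall p).1, (hsmall q).1], by simp [(hsmall p).2, (hsmall q).2]⟩,
    fun θ => ?_⟩
  have hfield : ((0, flowField n (connection η₁ η₂ a q - connection η₁ η₂ a p) θ) : Cov n)
      ≡ covField η₁ η₂ a (q, θ) - covField η₁ η₂ a (p, θ) [SMOD fixParametric n 0] := by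
    refine sModEq_prod_bot.2 ⟨sModEq_ker_coords.2 ?_, ?_⟩
    · rintro (b | ⟨b, i, j⟩) ⟨hlevel, -⟩
      · simp [covField, coord_base_totalField b a q p]
      · exact absurd hlevel (by simp [level])
    · funext k
      simp [covField, flowField, flow_sub]
  rw [hpot.plotSmoothOn.fderiv_prodMk_left hp.1,
    hpot.lineDeriv_eq_sub (p := (p, θ)) (q := (q, θ)) hd.plotOpen_positiveDomain hinv
      ⟨hp.1, hp_pos⟩ ⟨hq.1, hq_pos⟩ hp hq (sModEq_prod_bot.2 ⟨hpq, rfl⟩) hfield, flow_sub, map_sub]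
  rfl

end SmoothData

/-- The jet with `u = r`, `u_y = b` and `v = 1` at the point `(x, y)`, all other coordinates being
zero. -/
def testJet (x y r b : ℝ) : Jet :=
  ofCoord fun
    | base .x => x
    | base .y => y
    | fibre .x 0 0 => r
    | fibre .x 0 1 => b
    | fibre .y 0 0 => 1
    | _ => 0

variable {x y : ℝ}

lemma testJet_mem_jetDomain (hx : x ∈ I) (hy : y ∈ J) (hη : η₁ x ≠ η₂ y) {r : ℝ} (hr : 0 < r)
    (b : ℝ) : testJet x y r b ∈ jetDomain η₁ η₂ I J :=
  ⟨hx, hy, hη, hr.ne', one_ne_zero⟩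

lemma coord_jetNormal_testJet (r b : ℝ) {c : JetCoord} (hc : c.IsParametric) :
    coord c (jetNormal η₁ η₂ (testJet x y r b)) = coord c (testJet x y r b) :=
  sModEq_ker_coords.1 (jetNormal_sModEq_self c.level (testJet x y r b)) c ⟨le_rfl, .inl hc⟩

lemma connection_jetNormal_testJet (r b : ℝ) :
    connection η₁ η₂ .x (jetNormal η₁ η₂ (testJet x y r b))
      = (C (r : ℂ) * (C (1 / 2) * X * alphaSeries (η₁ x)),
        C (Complex.I * b) * alphaRatioSeries (η₂ y) (η₁ x),
        C (r : ℂ) * (C (1 / 2) * X * alphaSeries (η₁ x))) := by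
  rw [connection_congr (q := testJet x y r b) .x
    (fun a => coord_jetNormal_testJet r b (c := base a) trivial)
    (fun a => coord_jetNormal_testJet r b (c := fibre a 0 0) Nat.zero_lt_two)
    (coord_jetNormal_testJet r b (c := fibre .x 0 1) Nat.one_lt_two)]
  simp [connection, riccati, phase, eta, param, slope, testJet, Axis.other]

namespace SmoothData

variable (hd : SmoothData η₁ η₂ I J)
include hd

theorem not_isTrivialForm_omega (hne : ∃ x ∈ I, ∃ y ∈ J, η₁ x ≠ η₂ y) :
    ¬ IsTrivialForm η₁ η₂ I J (n := n) (omegaX η₁ η₂ n) (omegaY η₁ η₂ n) := by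
  intro htrivial
  obtain ⟨h, M, hpot, hinv⟩ := hd.exists_isPotential htrivial
  have hinv₀ : InvariantOn (positiveDomain η₁ η₂ I J n) (fixParametric n 0) h :=
    hd.invariantOn_fixParametric_zero hpot fun _ hp _ hq => hinv hp.1 hq.1
  obtain ⟨x, hx, y, hy, hη⟩ := hne
  let P (r b : ℝ) : Jet := jetNormal η₁ η₂ (testJet x y r b)
  have hP {r b : ℝ} (hr : 0 < r) : P r b ∈ equationManifold η₁ η₂ I J :=
    hd.jetNormal_mem (testJet_mem_jetDomain hx hy hη hr b)
  have hpos {r b : ℝ} (hr : 0 < r) (a : Axis) : 0 < coord (fibre a 0 0) (P r b) := by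
    rw [coord_jetNormal_testJet r b (c := fibre a 0 0) Nat.zero_lt_two]
    cases a
    exacts [hr, one_pos]
  have hbase (r b r' b' : ℝ) : P r b ≡ P r' b' [SMOD (coords (knownLE 0 0)).ker] := by
    rw [sModEq_ker_coords]
    rintro (a | ⟨a, i, j⟩) ⟨hlevel, -⟩
    · rw [coord_jetNormal_testJet r b (c := base a) trivial,
        coord_jetNormal_testJet r' b' (c := base a) trivial]
      cases a <;> rfl
    · exact absurd hlevel (by simp [level])
  have hlifts {r b : ℝ} (hr : 0 < r) := hd.lifts_connection_sub hpot hinv₀ (hP one_pos) (hP hr)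
    (hpos one_pos) (hpos hr) (hbase 1 0 r b) .x
  have hg : ContDiff ℝ ∞ fun θ : Fin n → ℂ => h (P 1 0, θ) := contDiff_iff_contDiffAt.2 fun θ =>
    hpot.plotSmoothOn.contDiffAt_comp (isPlotAt_prodMk_left _ θ) (hP one_pos).1
  refine not_lifts hg hη ?_ ?_
  · convert hlifts (b := 1) one_pos using 1
    simp [P, connection_jetNormal_testJet]
  · have hC : (C (2 : ℂ) : ℂ⟦X⟧) = 1 + 1 := by
      rw [← map_one C, ← map_add, one_add_one_eq_two]
    convert hlifts (b := 0) two_pos using 1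
    simp [P, connection_jetNormal_testJet, hC, add_mul]

end SmoothData

end Nontriviality

end SDeform

end

theorem mainTheorem2 (η₁ η₂ : ℝ → ℝ) (I J : Set ℝ) (hI : IsOpen I) (hJ : IsOpen J)
    (hη₁ : ContDiffOn ℝ ∞ η₁ I) (hη₂ : ContDiffOn ℝ ∞ η₂ J)
    (hne : ∃ x ∈ I, ∃ y ∈ J, η₁ x ≠ η₂ y) (s : ℕ) :
    SDeform.IsConservationLaw η₁ η₂ I J (n := s)
        (SDeform.omegaX η₁ η₂ s) (SDeform.omegaY η₁ η₂ s) ∧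
      ¬ SDeform.IsTrivialForm η₁ η₂ I J (n := s)
        (SDeform.omegaX η₁ η₂ s) (SDeform.omegaY η₁ η₂ s) :=
  have hd : SDeform.SmoothData η₁ η₂ I J := ⟨hI, hJ, hη₁, hη₂⟩
  ⟨hd.isConservationLaw_omega s, hd.not_isTrivialForm_omega hne⟩
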